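/- Let $R$ be an associative unital ring; "module" means left $R$-module, and right $R$-modules are modules over the opposite ring. A module $F$ is of type $\mathrm{FP}_\infty$ if it has a projective resolution by finitely generated modules. A module $A$ is absolutely clean if $\operatorname{Ext}^1_R(F,A)=0$ for all modules $F$ of type $\mathrm{FP}_\infty$; a module $L$ is level if $\operatorname{Tor}_1^R(F,L)=0$ for all right modules $F$ of type $\mathrm{FP}_\infty$. A module $M$ is Gorenstein projective (respectively Gorenstein AC-projective) if there is an exact sequence $\cdots\to P_1\to P_0\to P_{-1}\to\cdots$ of projective modules with $M\cong\operatorname{Coker}(P_1\to P_0)$ that remains exact after applying $\operatorname{Hom}_R(-,P)$ for every projective module $P$ (respectively $\operatorname{Hom}_R(-,L)$ for every level module $L$). A module $M$ is Gorenstein AC-injective if there is an exact sequence $\cdots\to I_1\to I_0\to I_{-1}\to\cdots$ of injective modules with $M\cong\operatorname{Coker}(I_1\to I_0)$ that remains exact after applying $\operatorname{Hom}_R(A,-)$ for every absolutely clean module $A$. The Gorenstein projective (respectively Gorenstein AC-projective) dimension of $M$ is the least $n\ge 0$ for which there is an exact sequence $0\to G_n\to\cdots\to G_0\to M\to 0$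 with all $G_i$ Gorenstein projective (respectively Gorenstein AC-projective), and $\infty$ if there is none. The Gorenstein AC-injective dimension of $M$ is the least $n\ge 0$ for which there is an exact sequence $0\to M\to G^0\to\cdots\to G^n\to 0$ with all $G^i$ Gorenstein AC-injective, and $\infty$ if there is none. Let $\operatorname{Ggldim}R$, $\operatorname{GPac\text{-}gldim}R$ and $\operatorname{GIac\text{-}gldim}R$ be the suprema, over all modules $M$, of the Gorenstein projective, Gorenstein AC-projective and Gorenstein AC-injective dimensions of $M$. Let $\operatorname{silac}R$ be the supremum of the injective dimensions of all absolutely clean modules, and $\operatorname{spll}R$ the supremum of the projective dimensions of all level modules (the zero module has injective and projective dimension $-\infty$). Then, as equalities in $\{-\infty\}\cup\mathbb{N}\cup\{\infty\}$, $$\operatorname{GIac\text{-}gldim}R=\max\{\operatorname{Ggldim}R,\ \operatorname{silac}R\} \qquad\text{and}\qquad \operatorname{GPac\text{-}gldim}R=\max\{\operatorname{Ggldim}R,\ \operatorname{spll}R\}.$$ -/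

import Mathlib

open CategoryTheory CategoryTheory.Limits
open scoped TensorProduct

universe u

noncomputable section

namespace GorensteinAC

/-! ### Modules of type FP∞, absolutely clean modules -/

/-- A module is of type FP∞ if it has a projective resolution by finitely generated modules.
Left `R`-modules are objects of `ModuleCat R`, right `R`-modules are objects of
`ModuleCat Rᵐᵒᵖ`. -/
def IsTypeFPInfty {R : Type u} [Ring R] (F : ModuleCat.{u} R) : Prop :=
  ∃ P : ProjectiveResolution F, ∀ i : ℕ, Module.Finite R (P.complex.X i)

/-- A left `R`-module `A` is absolutely clean if `Ext¹_R(F, A) = 0` for all left `R`-modules `F`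
of type FP∞. -/
def IsAbsolutelyClean {R : Type u} [Ring R] (A : ModuleCat.{u} R) : Prop :=
  ∀ F : ModuleCat.{u} R, IsTypeFPInfty F → Subsingleton (Abelian.Ext F A 1)

/-! ### Tensor products and `Tor` over a noncommutative ring, level modules -/

section Tensor

variable {R : Type u} [Ring R]

/-- The subgroup of `N ⊗_ℤ L` generated by all `nr ⊗ l - n ⊗ rl`, where `N` is a right and `L` is a
left `R`-module. -/
def balancedRelations (N : ModuleCat.{u} Rᵐᵒᵖ) (L : ModuleCat.{u} R) : Submodule ℤ (N ⊗[ℤ] L) :=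
  Submodule.span ℤ
    {x | ∃ (n : N) (r : R) (l : L), x = (MulOpposite.op r • n) ⊗ₜ[ℤ] l - n ⊗ₜ[ℤ] (r • l)}

/-- The additive map `N ⊗_ℤ L → N' ⊗_ℤ L` induced by an `R`-linear map `N → N'`. -/
def rTensorInt {N N' : ModuleCat.{u} Rᵐᵒᵖ} (f : N ⟶ N') (L : ModuleCat.{u} R) :
    (N ⊗[ℤ] L) →ₗ[ℤ] (N' ⊗[ℤ] L) :=
  LinearMap.rTensor L f.hom.toAddMonoidHom.toIntLinearMap

@[simp]
lemma rTensorInt_tmul {N N' : ModuleCat.{u} Rᵐᵒᵖ} (f : N ⟶ N') (L : ModuleCat.{u} R)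
    (n : N) (l : L) : rTensorInt f L (n ⊗ₜ[ℤ] l) = (f.hom n) ⊗ₜ[ℤ] l := rfl

lemma balancedRelations_le_comap {N N' : ModuleCat.{u} Rᵐᵒᵖ} (f : N ⟶ N') (L : ModuleCat.{u} R) :
    balancedRelations N L ≤ (balancedRelations N' L).comap (rTensorInt f L) := by
  refine Submodule.span_le.2 ?_
  rintro _ ⟨n, r, l, rfl⟩
  refine Submodule.subset_span ⟨f.hom n, r, l, ?_⟩
  rw [map_sub, rTensorInt_tmul, rTensorInt_tmul, map_smul]

/-- The tensor product `N ⊗_R L` of a right and a left `R`-module, an abelian group. -/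
abbrev BalancedTensor (N : ModuleCat.{u} Rᵐᵒᵖ) (L : ModuleCat.{u} R) : Type u :=
  (N ⊗[ℤ] L) ⧸ balancedRelations N L

/-- The map `f ⊗_R L : N ⊗_R L → N' ⊗_R L`. -/
def balancedMap {N N' : ModuleCat.{u} Rᵐᵒᵖ} (f : N ⟶ N') (L : ModuleCat.{u} R) :
    BalancedTensor N L →ₗ[ℤ] BalancedTensor N' L :=
  Submodule.mapQ _ _ (rTensorInt f L) (balancedRelations_le_comap f L)

@[simp]
lemma balancedMap_mk_tmul {N N' : ModuleCat.{u} Rᵐᵒᵖ} (f : N ⟶ N') (L : ModuleCat.{u} R)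
    (n : N) (l : L) :
    balancedMap f L (Submodule.Quotient.mk (n ⊗ₜ[ℤ] l)) =
      Submodule.Quotient.mk ((f.hom n) ⊗ₜ[ℤ] l) := rfl

lemma balancedTensor_hom_ext {N : ModuleCat.{u} Rᵐᵒᵖ} {L : ModuleCat.{u} R} {A : Type*}
    [AddCommGroup A] {g h : BalancedTensor N L →ₗ[ℤ] A}
    (H : ∀ (n : N) (l : L),
      g (Submodule.Quotient.mk (n ⊗ₜ[ℤ] l)) = h (Submodule.Quotient.mk (n ⊗ₜ[ℤ] l))) : g = h :=
  Submodule.linearMap_qext _ (TensorProduct.ext' H)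

lemma balancedMap_id (N : ModuleCat.{u} Rᵐᵒᵖ) (L : ModuleCat.{u} R) :
    balancedMap (𝟙 N) L = LinearMap.id :=
  balancedTensor_hom_ext fun _ _ => rfl

lemma balancedMap_comp {N N' N'' : ModuleCat.{u} Rᵐᵒᵖ} (f : N ⟶ N') (g : N' ⟶ N'')
    (L : ModuleCat.{u} R) : balancedMap (f ≫ g) L = balancedMap g L ∘ₗ balancedMap f L :=
  balancedTensor_hom_ext fun _ _ => rfl

lemma balancedMap_add {N N' : ModuleCat.{u} Rᵐᵒᵖ} (f g : N ⟶ N') (L : ModuleCat.{u} R) :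
    balancedMap (f + g) L = balancedMap f L + balancedMap g L :=
  balancedTensor_hom_ext fun n l => by
    rw [LinearMap.add_apply, balancedMap_mk_tmul, balancedMap_mk_tmul, balancedMap_mk_tmul,
      ModuleCat.hom_add, LinearMap.add_apply, TensorProduct.add_tmul, Submodule.Quotient.mk_add]

/-- The functor `- ⊗_R L` from right `R`-modules to abelian groups, for a left `R`-module `L`. -/
def tensorFunctor (L : ModuleCat.{u} R) : ModuleCat.{u} Rᵐᵒᵖ ⥤ ModuleCat.{u} ℤ where
  obj N := ModuleCat.of ℤ (BalancedTensor N L)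
  map f := ModuleCat.ofHom (balancedMap f L)
  map_id N := by rw [balancedMap_id]; rfl
  map_comp f g := by rw [balancedMap_comp]; rfl

instance tensorFunctor_additive (L : ModuleCat.{u} R) : (tensorFunctor L).Additive where
  map_add {N N' f g} := by
    change ModuleCat.ofHom (balancedMap (f + g) L) = _
    rw [balancedMap_add]; rfl

/-- `Tor_i^R(N, L)`, as the value at `N` of the `i`-th left derived functor of `- ⊗_R L`. -/
def tor (i : ℕ) (N : ModuleCat.{u} Rᵐᵒᵖ) (L : ModuleCat.{u} R) : ModuleCat.{u} ℤ :=
  ((tensorFunctor L).leftDerived i).obj N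

end Tensor

/-- A left `R`-module `L` is level if `Tor_1^R(F, L) = 0` for all right `R`-modules `F` of type
FP∞. -/
def IsLevel {R : Type u} [Ring R] (L : ModuleCat.{u} R) : Prop :=
  ∀ F : ModuleCat.{u} Rᵐᵒᵖ, IsTypeFPInfty F → IsZero (tor 1 F L)

/-! ### Gorenstein projective, Gorenstein AC-projective and Gorenstein AC-injective modules -/

section Gorenstein

variable {R : Type u} [Ring R]

/-- There is an exact sequence `⋯ → P₁ → P₀ → P₋₁ → ⋯` of projective modules with
`M ≅ Coker(P₁ → P₀)` that remains exact under `Hom(-, Y)` for every `Y` in the class `𝒴`. -/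
def HasCompleteProjRes (𝒴 : ObjectProperty (ModuleCat.{u} R)) (M : ModuleCat.{u} R) : Prop :=
  ∃ P : ChainComplex (ModuleCat.{u} R) ℤ,
    (∀ i, Projective (P.X i)) ∧ P.Acyclic ∧ Nonempty (M ≅ cokernel (P.d 1 0)) ∧
    ∀ Y, 𝒴 Y → ∀ i : ℤ, Function.Exact
      (fun g : P.X (i - 1) ⟶ Y => P.d i (i - 1) ≫ g)
      (fun g : P.X i ⟶ Y => P.d (i + 1) i ≫ g)

/-- There is an exact sequence `⋯ → I₁ → I₀ → I₋₁ → ⋯` of injective modules with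
`M ≅ Coker(I₁ → I₀)` that remains exact under `Hom(X, -)` for every `X` in the class `𝒳`. -/
def HasCompleteInjRes (𝒳 : ObjectProperty (ModuleCat.{u} R)) (M : ModuleCat.{u} R) : Prop :=
  ∃ I : ChainComplex (ModuleCat.{u} R) ℤ,
    (∀ i, Injective (I.X i)) ∧ I.Acyclic ∧ Nonempty (M ≅ cokernel (I.d 1 0)) ∧
    ∀ X, 𝒳 X → ∀ i : ℤ, Function.Exact
      (fun g : X ⟶ I.X (i + 1) => g ≫ I.d (i + 1) i)
      (fun g : X ⟶ I.X i => g ≫ I.d i (i - 1))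

/-- Gorenstein projective modules. -/
def IsGorensteinProjective : ObjectProperty (ModuleCat.{u} R) :=
  fun M => HasCompleteProjRes (fun P => Projective P) M

/-- Gorenstein AC-projective modules. -/
def IsGorensteinACProjective : ObjectProperty (ModuleCat.{u} R) :=
  fun M => HasCompleteProjRes (fun L => IsLevel L) M

/-- Gorenstein AC-injective modules. -/
def IsGorensteinACInjective : ObjectProperty (ModuleCat.{u} R) :=
  fun M => HasCompleteInjRes (fun A => IsAbsolutelyClean A) M

/-! ### Relative dimensions -/

/-- There is an exact sequence `0 → Gₙ → ⋯ → G₀ → M → 0` with all `Gᵢ` in the class `𝒢`. It is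
written as an acyclic complex with `M` in degree `0`, `Gᵢ` in degree `i + 1` for `i ≤ n`, and zero
in all higher degrees. -/
def HasResolutionOfLength (𝒢 : ObjectProperty (ModuleCat.{u} R)) (n : ℕ)
    (M : ModuleCat.{u} R) : Prop :=
  ∃ G : ChainComplex (ModuleCat.{u} R) ℕ, G.Acyclic ∧ Nonempty (G.X 0 ≅ M) ∧
    (∀ i ≤ n, 𝒢 (G.X (i + 1))) ∧ ∀ i > n, IsZero (G.X (i + 1))

/-- There is an exact sequence `0 → M → G⁰ → ⋯ → Gⁿ → 0` with all `Gⁱ` in the class `𝒢`. It is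
written as an acyclic complex with `M` in degree `0`, `Gⁱ` in degree `i + 1` for `i ≤ n`, and zero
in all higher degrees. -/
def HasCoresolutionOfLength (𝒢 : ObjectProperty (ModuleCat.{u} R)) (n : ℕ)
    (M : ModuleCat.{u} R) : Prop :=
  ∃ G : CochainComplex (ModuleCat.{u} R) ℕ, G.Acyclic ∧ Nonempty (G.X 0 ≅ M) ∧
    (∀ i ≤ n, 𝒢 (G.X (i + 1))) ∧ ∀ i > n, IsZero (G.X (i + 1))

/-- The least length of a resolution of `M` by modules in `𝒢` (`⊤` if there is no finite one). -/
def resolutionDim (𝒢 : ObjectProperty (ModuleCat.{u} R)) (M : ModuleCat.{u} R) : ℕ∞ :=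
  ⨅ (n : ℕ) (_ : HasResolutionOfLength 𝒢 n M), (n : ℕ∞)

/-- The least length of a coresolution of `M` by modules in `𝒢` (`⊤` if there is no finite one). -/
def coresolutionDim (𝒢 : ObjectProperty (ModuleCat.{u} R)) (M : ModuleCat.{u} R) : ℕ∞ :=
  ⨅ (n : ℕ) (_ : HasCoresolutionOfLength 𝒢 n M), (n : ℕ∞)

/-- Gorenstein projective dimension `Gpd M`. -/
def gorensteinProjDim (M : ModuleCat.{u} R) : ℕ∞ :=
  resolutionDim IsGorensteinProjective M

/-- Gorenstein AC-projective dimension `Gac-pd M`. -/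
def gorensteinACProjDim (M : ModuleCat.{u} R) : ℕ∞ :=
  resolutionDim IsGorensteinACProjective M

/-- Gorenstein AC-injective dimension `Gac-id M`. -/
def gorensteinACInjDim (M : ModuleCat.{u} R) : ℕ∞ :=
  coresolutionDim IsGorensteinACInjective M

end Gorenstein

/-! ### Global invariants of a ring -/

section Global

variable (R : Type u) [Ring R]

/-- The global Gorenstein dimension `Ggldim R`. -/
def gGldim : ℕ∞ := ⨆ M : ModuleCat.{u} R, gorensteinProjDim M

/-- The global Gorenstein AC-projective dimension `GPac-gldim R`. -/
def gPacGldim : ℕ∞ := ⨆ M : ModuleCat.{u} R, gorensteinACProjDim M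

/-- The global Gorenstein AC-injective dimension `GIac-gldim R`. -/
def gIacGldim : ℕ∞ := ⨆ M : ModuleCat.{u} R, gorensteinACInjDim M

/-- `silac R`, the supremum of the injective dimensions of the absolutely clean modules. The
injective dimension of the zero module is `⊥`, hence the values in `WithBot ℕ∞`. -/
def silac : WithBot ℕ∞ :=
  ⨆ (A : ModuleCat.{u} R) (_ : IsAbsolutelyClean A), injectiveDimension A

/-- `spll R`, the supremum of the projective dimensions of the level modules. The projective
dimension of the zero module is `⊥`, hence the values in `WithBot ℕ∞`. -/
def spll : WithBot ℕ∞ :=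
  ⨆ (L : ModuleCat.{u} R) (_ : IsLevel L), projectiveDimension L

end Global

end GorensteinAC

end

/-! Both equalities follow from one equivalence per natural number `n`: the Gorenstein AC dimension
on the left is at most `n` iff both dimensions on the right are (`gPacGldim_le_iff`,
`gIacGldim_le_iff`). Three facts about an abelian category with enough projectives and injectives,
and a class 𝒴 of objects, give these equivalences.

(A) If every object has a resolution of length at most `n` by Gorenstein projectives relative to 𝒴,
then objects of 𝒴 have injective dimension at most `n`, by dimension shifting
(`hasInjectiveDimensionLE_of_resolves`).

(B) If moreover 𝒴 contains the projectives, every object of finite injective dimension has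
projective dimension at most `n` (`hasProjectiveDimensionLE_of_resolves`). Indeed relative
Gorenstein projectives have no higher Ext into such an object, so it can be compared with its own
Gorenstein resolution.

(C) If injectives have projective dimension at most `n` and objects of 𝒴 have finite injective
dimension, then `n`-th syzygies are Gorenstein projective relative to 𝒴, so every object has a
resolution of length `n` (`resolves_of_hasProjectiveDimensionLE`).

For GPac, 𝒴 is the class of level modules, which contains the projectives. A bound there makes
injective modules (B) and level modules (A, then B) of projective dimension at most `n`, and (C) for
the class of projectives bounds Ggldim. Conversely, a bound on Ggldim bounds the projective
dimension of injectives (B) and the injective dimension of projectives (A), hence that of level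
modules once spll is finite, and (C) applies. For GIac the same facts are used in the opposite
category, with the opposite of the class of absolutely clean modules. Of level and absolutely clean
modules one needs only that they include the projectives and the injectives respectively. -/

noncomputable section

namespace GorensteinAC

universe w v u'

section Abstract

open ZeroObject

variable {C : Type u'} [Category.{v} C] [Abelian C]

/-! ### Relative Gorenstein projective objects of an abelian category -/

/-- A `ℤ`-indexed family of short exact sequences `0 → Zᵢ₊₁ → Xᵢ → Zᵢ → 0` with all `Xᵢ` projective
such that every map from `Zᵢ₊₁` to an object in `𝒴` extends to `Xᵢ`. -/
structure IsTotalSequence (𝒴 : ObjectProperty C) (S : ℤ → ShortComplex C) : Prop where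
  shortExact : ∀ i, (S i).ShortExact
  projective : ∀ i, Projective (S i).X₂
  link : ∀ i, Nonempty ((S (i + 1)).X₃ ≅ (S i).X₁)
  extend : ∀ i Y, 𝒴 Y → ∀ a : (S i).X₁ ⟶ Y, ∃ b, (S i).f ≫ b = a

/-- The objects occurring as cycles of a totally acyclic complex of projectives relative to `𝒴`. -/
def IsRelGorensteinProjective (𝒴 : ObjectProperty C) : ObjectProperty C :=
  fun M => ∃ S, IsTotalSequence 𝒴 S ∧ Nonempty ((S 0).X₃ ≅ M)

/-- `M` has a resolution of length `n` by objects in `𝒢`. -/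
inductive Resolves (𝒢 : ObjectProperty C) : ℕ → C → Prop
  | zero {M : C} : 𝒢 M → Resolves 𝒢 0 M
  | succ {n : ℕ} {K G M : C} {f : K ⟶ G} {g : G ⟶ M} {w : f ≫ g = 0} :
      (ShortComplex.mk f g w).ShortExact → 𝒢 G → Resolves 𝒢 n K → Resolves 𝒢 (n + 1) M

/-- `K` is an `n`-th syzygy of `N`. -/
inductive IsSyzygy : ℕ → C → C → Prop
  | refl (N : C) : IsSyzygy 0 N N
  | step {n : ℕ} {N K P K' : C} {f : K ⟶ P} {g : P ⟶ K'} {w : f ≫ g = 0} :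
      (ShortComplex.mk f g w).ShortExact → Projective P → IsSyzygy n N K' → IsSyzygy (n + 1) N K

/-- Every object in `𝒦` is a kernel of an epimorphism from a projective to an object in `𝒦`. -/
def HasProjectiveCosyzygies (𝒦 : ObjectProperty C) : Prop :=
  ∀ G, 𝒦 G → ∃ (P G' : C) (f : G ⟶ P) (g : P ⟶ G') (w : f ≫ g = 0),
    (ShortComplex.mk f g w).ShortExact ∧ Projective P ∧ 𝒦 G'

/-- Passing to a cosyzygy raises the Ext degree by one without leaving 𝒦; after enough passages the
degree reaches the bound `m`. -/
lemma ext_eq_zero_of_cosyzygies [HasExt.{w} C] {𝒦 : ObjectProperty C}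
    (h𝒦 : HasProjectiveCosyzygies 𝒦) (L : C) (m : ℕ) [HasInjectiveDimensionLT L m] :
    ∀ G, 𝒦 G → ∀ (k : ℕ) (e : Abelian.Ext.{w} G L (k + 1)), e = 0 := by
  suffices ∀ (j : ℕ) (G : C), 𝒦 G → ∀ (k : ℕ), m ≤ k + 1 + j →
      ∀ e : Abelian.Ext.{w} G L (k + 1), e = 0 from
    fun G hG k e => this m G hG k (by lia) e
  intro j
  induction j with
  | zero => exact fun G _ k hk e => e.eq_zero_of_hasInjectiveDimensionLT m hk
  | succ j ih =>
    intro G hG k hk e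
    obtain ⟨P, G', f, g, w, hS, hP, hG'⟩ := h𝒦 G hG
    obtain ⟨x, rfl⟩ := Abelian.Ext.contravariant_sequence_exact₁ hS L e
      (add_comm 1 (k + 1)) (ih G' hG' (k + 1) (by lia) _)
    have : x = 0 := Abelian.Ext.eq_zero_of_projective x
    rw [this, Abelian.Ext.comp_zero]

lemma exists_extension_of_ext_eq_zero [HasExt.{w} C] {S : ShortComplex C} (hS : S.ShortExact)
    {Y : C} (h : ∀ e : Abelian.Ext.{w} S.X₃ Y 1, e = 0) (a : S.X₁ ⟶ Y) :
    ∃ b, S.f ≫ b = a := by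
  obtain ⟨x, hx⟩ := Abelian.Ext.contravariant_sequence_exact₁ hS Y (Abelian.Ext.mk₀ a)
    (add_comm 1 0) (h _)
  obtain ⟨b, rfl⟩ := Abelian.Ext.homEquiv₀.symm.surjective x
  exact ⟨b, Abelian.Ext.homEquiv₀.symm.injective (by simpa using hx)⟩

lemma exists_lift_of_ext_eq_zero [HasExt.{w} C] {S : ShortComplex C} (hS : S.ShortExact)
    {X : C} (h : ∀ e : Abelian.Ext.{w} X S.X₁ 1, e = 0) (a : X ⟶ S.X₃) :
    ∃ b, b ≫ S.g = a := by
  obtain ⟨x, hx⟩ := Abelian.Ext.covariant_sequence_exact₃ X hS (Abelian.Ext.mk₀ a)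
    (zero_add 1) (h _)
  obtain ⟨b, rfl⟩ := Abelian.Ext.homEquiv₀.symm.surjective x
  exact ⟨b, Abelian.Ext.homEquiv₀.symm.injective (by simpa using hx)⟩

lemma shortExact_of_iso_left {K' K P M : C} {f : K ⟶ P} {g : P ⟶ M} {w : f ≫ g = 0}
    (h : (ShortComplex.mk f g w).ShortExact) (e : K' ≅ K) :
    (ShortComplex.mk (e.hom ≫ f) g (by rw [Category.assoc, w, comp_zero])).ShortExact :=
  ShortComplex.shortExact_of_iso
    (ShortComplex.isoMk (S₁ := .mk f g w) (S₂ := .mk (e.hom ≫ f) g _) e.symm (Iso.refl _)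
      (Iso.refl _) (by simp) (by simp)) h

lemma shortExact_of_iso_right {K P M M' : C} {f : K ⟶ P} {g : P ⟶ M} {w : f ≫ g = 0}
    (h : (ShortComplex.mk f g w).ShortExact) (e : M ≅ M') :
    (ShortComplex.mk f (g ≫ e.hom) (by rw [← Category.assoc, w, zero_comp])).ShortExact :=
  ShortComplex.shortExact_of_iso
    (ShortComplex.isoMk (S₁ := .mk f g w) (S₂ := .mk f (g ≫ e.hom) _) (Iso.refl _)
      (Iso.refl _) e (by simp) (by simp)) h

/-! ### Ext vanishing for relative Gorenstein projectives -/

namespace IsTotalSequence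

variable {𝒴 : ObjectProperty C} {S : ℤ → ShortComplex C}

lemma hasProjectiveCosyzygies (hS : IsTotalSequence 𝒴 S) :
    HasProjectiveCosyzygies (fun G : C => ∃ i, Nonempty ((S i).X₃ ≅ G)) := by
  rintro G ⟨i, ⟨e⟩⟩
  obtain ⟨j, rfl⟩ : ∃ j, i = j + 1 := ⟨i - 1, by simp⟩
  obtain ⟨e'⟩ := hS.link j
  exact ⟨_, (S j).X₃, _, _, _, shortExact_of_iso_left (hS.shortExact j) (e.symm ≪≫ e'),
    hS.projective j, j, ⟨Iso.refl _⟩⟩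

lemma ext_eq_zero [HasExt.{w} C] (hS : IsTotalSequence 𝒴 S) {Y : C} (hY : 𝒴 Y) (k : ℕ) :
    ∀ (i : ℤ) (e : Abelian.Ext.{w} (S i).X₃ Y (k + 1)), e = 0 := by
  induction k with
  | zero =>
    intro i e
    have := hS.projective i
    -- As the middle term is projective, `e` is the connecting image of a map `(S i).X₁ ⟶ Y`; that
    -- map extends to the middle term, so its connecting image is zero.
    obtain ⟨x, rfl⟩ := Abelian.Ext.contravariant_sequence_exact₃ (hS.shortExact i) Y e
      (Abelian.Ext.eq_zero_of_projective _) (add_comm 1 0)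
    obtain ⟨a, rfl⟩ := Abelian.Ext.homEquiv₀.symm.surjective x
    obtain ⟨b, rfl⟩ := hS.extend i Y hY a
    simp only [Abelian.Ext.homEquiv₀_symm_apply]
    rw [← Abelian.Ext.mk₀_comp_mk₀, ← Abelian.Ext.comp_assoc_of_second_deg_zero,
      (hS.shortExact i).extClass_comp, Abelian.Ext.zero_comp]
  | succ k ih =>
    intro i e
    have := hS.projective i
    obtain ⟨x, rfl⟩ := Abelian.Ext.contravariant_sequence_exact₃ (hS.shortExact i) Y e
      (Abelian.Ext.eq_zero_of_projective _) (add_comm 1 (k + 1))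
    obtain ⟨e'⟩ := hS.link i
    have h0 := ih (i + 1) ((Abelian.Ext.mk₀ e'.hom).comp x (zero_add _))
    have : x = 0 := by
      rw [← Abelian.Ext.mk₀_id_comp x, ← e'.inv_hom_id, ← Abelian.Ext.mk₀_comp_mk₀,
        Abelian.Ext.comp_assoc_of_second_deg_zero, h0, Abelian.Ext.comp_zero]
    rw [this, Abelian.Ext.comp_zero]

end IsTotalSequence

section Rel

variable {𝒴 : ObjectProperty C}

lemma IsRelGorensteinProjective.of_iso {M N : C} (h : IsRelGorensteinProjective 𝒴 M)
    (e : M ≅ N) : IsRelGorensteinProjective 𝒴 N := by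
  obtain ⟨S, hS, ⟨e'⟩⟩ := h
  exact ⟨S, hS, ⟨e' ≪≫ e⟩⟩

/-- The sequence at index `-1` exhibits the cosyzygy, and shifting the whole family by one shows
that it is again relative Gorenstein projective. -/
lemma IsRelGorensteinProjective.hasProjectiveCosyzygies :
    HasProjectiveCosyzygies (IsRelGorensteinProjective 𝒴) := by
  rintro G ⟨S, hS, ⟨e⟩⟩
  obtain ⟨e'⟩ := hS.link (-1)
  refine ⟨_, (S (-1)).X₃, _, _, _, shortExact_of_iso_left (hS.shortExact (-1)) (e.symm ≪≫ e'),
    hS.projective _, fun i => S (i - 1), ⟨fun i => hS.shortExact _, fun i => hS.projective _,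
      fun i => ?_, fun i => hS.extend _⟩, ⟨Iso.refl _⟩⟩
  obtain ⟨e''⟩ := hS.link (i - 1)
  exact ⟨eqToIso (by rw [add_sub_right_comm]) ≪≫ e''⟩

lemma IsRelGorensteinProjective.ext_eq_zero [HasExt.{w} C] {G : C}
    (hG : IsRelGorensteinProjective 𝒴 G) {Y : C} (hY : 𝒴 Y) (k : ℕ)
    (x : Abelian.Ext.{w} G Y (k + 1)) : x = 0 := by
  obtain ⟨S, hS, ⟨e⟩⟩ := hG
  rw [← Abelian.Ext.mk₀_id_comp x, ← e.inv_hom_id, ← Abelian.Ext.mk₀_comp_mk₀,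
    Abelian.Ext.comp_assoc_of_second_deg_zero,
    hS.ext_eq_zero hY k 0 ((Abelian.Ext.mk₀ e.hom).comp x (zero_add _)), Abelian.Ext.comp_zero]

lemma Resolves.ext_eq_zero [HasExt.{w} C] {n : ℕ} {M : C}
    (h : Resolves (IsRelGorensteinProjective 𝒴) n M) {Y : C} (hY : 𝒴 Y) :
    ∀ (k : ℕ) (x : Abelian.Ext.{w} M Y (n + k + 1)), x = 0 := by
  induction h with
  | zero hM => exact fun k x => hM.ext_eq_zero hY _ x
  | @succ n K G M f g w hS hG _ ih =>
    intro k x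
    obtain ⟨y, rfl⟩ := Abelian.Ext.contravariant_sequence_exact₃ hS Y x
      (hG.ext_eq_zero hY _ _) (show 1 + (n + k + 1) = n + 1 + k + 1 by lia)
    rw [ih k y, Abelian.Ext.comp_zero]

/-! ### Finite injective dimension bounds projective dimension -/

/-- If the identity of an object `L` of finite injective dimension factors through `N ⊕ Q`, where
`N` has a resolution of length `n` by objects in `𝒢` and `Q` is projective, then `L` has projective
dimension at most `n`. -/
lemma Resolves.hasProjectiveDimensionLE_of_factors [EnoughProjectives C] {𝒢 : ObjectProperty C}
    (h𝒢 : HasProjectiveCosyzygies 𝒢) {d : ℕ}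
    (hd : ∀ P : C, Projective P → HasInjectiveDimensionLT P d) {n : ℕ} {N : C}
    (hN : Resolves 𝒢 n N) :
    ∀ (L : C) (m : ℕ) [HasInjectiveDimensionLT L m] {Q : C} [Projective Q]
      (a : L ⟶ N) (b : N ⟶ L) (s : L ⟶ Q) (t : Q ⟶ L), a ≫ b + s ≫ t = 𝟙 L →
      HasProjectiveDimensionLE L n := by
  let := HasExt.standard C
  induction hN with
  | @zero G hG =>
    intro L m _ Q _ a b s t h
    -- Since Ext¹ from the cosyzygy `G'` to `L` vanishes, `b` extends along `G ⟶ P`, which makes `L`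
    -- a retract of the projective `P ⊞ Q`.
    obtain ⟨P, G', f, g, w, hS, hP, hG'⟩ := h𝒢 G hG
    obtain ⟨b', rfl⟩ := exists_extension_of_ext_eq_zero hS
      (ext_eq_zero_of_cosyzygies h𝒢 L m G' hG' 0) b
    have r : Retract L (P ⊞ Q) :=
      ⟨biprod.lift (a ≫ f) s, biprod.desc b' t, by simpa using h⟩
    exact r.hasProjectiveDimensionLT 1
  | @succ n K G N f g w hS hG _ ih =>
    intro L m _ Q _ a b s t h
    -- The factorization is passed on to `kernel π`, with `K` in place of `N` and `Projective.over
    -- L` in place of `Q`. Comparison maps are unique only up to maps through projectives, which is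
    -- why the statement carries the summand `Q`.
    let π := Projective.π L
    let ι := kernel.ι π
    have hL : (ShortComplex.mk ι π (kernel.condition π)).ShortExact :=
      { exact := ShortComplex.exact_kernel π }
    have hK : HasInjectiveDimensionLT (kernel π) (max m d + 1) := by
      refine hL.hasInjectiveDimensionLT_X₁ _ (hasInjectiveDimensionLT_of_ge L m _ (by simp)) ?_
      have := hd (Projective.over L) inferInstance
      exact hasInjectiveDimensionLT_of_ge (Projective.over L) d _ (by lia)
    have : Epi g := hS.epi_g
    have : Mono f := hS.mono_f
    let α : Projective.over L ⟶ G := Projective.factorThru (π ≫ a) g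
    have hα : α ≫ g = π ≫ a := Projective.factorThru_comp _ _
    -- `G` need not be projective; the lift exists because `kernel π` has finite injective
    -- dimension, so Ext¹ from `G` to it vanishes. This uses the bound `d` for projectives.
    obtain ⟨β, hβ⟩ := exists_lift_of_ext_eq_zero hL
      (ext_eq_zero_of_cosyzygies h𝒢 (kernel π) (max m d + 1) G hG 0) (g ≫ b)
    let τ : Q ⟶ Projective.over L := Projective.factorThru t π
    have hτ : τ ≫ π = t := Projective.factorThru_comp _ _
    dsimp only at hβ
    let a' : kernel π ⟶ K := hS.fIsKernel.lift (KernelFork.ofι (ι ≫ α)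
      (by dsimp only; rw [Category.assoc, hα, ← Category.assoc, kernel.condition, zero_comp]))
    have ha' : a' ≫ f = ι ≫ α := Fork.IsLimit.lift_ι hS.fIsKernel
    let b' : K ⟶ kernel π := kernel.lift π (f ≫ β)
      (by rw [Category.assoc, hβ, ← Category.assoc, w, zero_comp])
    have hb' : b' ≫ ι = f ≫ β := kernel.lift_ι _ _ _
    -- The hypothesis `h` says that the lifted endomorphism agrees with the identity modulo `kernel
    -- π`. The difference `η` plays the role of a homotopy: restricted to the kernel it gives `a' ≫
    -- b' + ι ≫ η = 𝟙`.
    let η : Projective.over L ⟶ kernel π := kernel.lift π (𝟙 _ - (α ≫ β + π ≫ s ≫ τ)) (by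
      have := congrArg (π ≫ ·) h
      simp only [Preadditive.comp_add, Category.comp_id] at this
      rw [Preadditive.sub_comp, Preadditive.add_comp, Category.assoc, Category.assoc,
        Category.assoc, hβ, hτ, ← Category.assoc α, hα, Category.assoc, this, Category.id_comp,
        sub_self])
    have hη : η ≫ ι = 𝟙 _ - (α ≫ β + π ≫ s ≫ τ) := kernel.lift_ι _ _ _
    have := ih (kernel π) (max m d + 1) a' b' ι η (by
      rw [← cancel_mono ι, Preadditive.add_comp, Category.assoc, Category.assoc, hb', hη,
        ← Category.assoc, ha', Preadditive.comp_sub, Preadditive.comp_add, Category.id_comp,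
        Category.comp_id, ← Category.assoc ι π, kernel.condition, zero_comp, add_zero,
        Category.assoc, add_sub_cancel])
    exact hL.hasProjectiveDimensionLT_X₃ (n + 1) this inferInstance

/-- If all objects have relative Gorenstein projective resolutions of length at most `n`, then
objects in `𝒴` have injective dimension at most `n`. -/
theorem hasInjectiveDimensionLE_of_resolves {n : ℕ}
    (h : ∀ M : C, ∃ k ≤ n, Resolves (IsRelGorensteinProjective 𝒴) k M) {Y : C} (hY : 𝒴 Y) :
    HasInjectiveDimensionLE Y n := by
  let := HasExt.standard C
  refine HasInjectiveDimensionLT.mk fun i hi M e => ?_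
  obtain ⟨k, hk, hM⟩ := h M
  obtain ⟨j, rfl⟩ : ∃ j, i = k + j + 1 := ⟨i - k - 1, by lia⟩
  exact hM.ext_eq_zero hY j e

/-- If all objects have relative Gorenstein projective resolutions of length at most `n`, then
objects of finite injective dimension have projective dimension at most `n`. -/
theorem hasProjectiveDimensionLE_of_resolves [EnoughProjectives C]
    (h𝒴 : ∀ P : C, Projective P → 𝒴 P) {n : ℕ}
    (h : ∀ M : C, ∃ k ≤ n, Resolves (IsRelGorensteinProjective 𝒴) k M) (L : C) (m : ℕ)
    [HasInjectiveDimensionLT L m] : HasProjectiveDimensionLE L n := by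
  obtain ⟨k, hk, hL⟩ := h L
  have := hL.hasProjectiveDimensionLE_of_factors
    IsRelGorensteinProjective.hasProjectiveCosyzygies
    (fun P hP => hasInjectiveDimensionLE_of_resolves h (h𝒴 P hP)) L m (Q := 0) (𝟙 L) (𝟙 L) 0 0
    (by simp)
  exact hasProjectiveDimensionLT_of_ge L (k + 1) (n + 1) (by lia)

end Rel

/-! ### Syzygies -/

lemma IsSyzygy.hasProjectiveDimensionLT {n k : ℕ} {N K : C} (h : IsSyzygy n N K) :
    HasProjectiveDimensionLT N (n + k + 1) → HasProjectiveDimensionLT K (k + 1) := by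
  induction h generalizing k with
  | refl N => intro h; rwa [zero_add] at h
  | @step n N K P K' f g w hS hP _ ih =>
    intro h
    have h' := ih (k := k + 1) (by rwa [show n + (k + 1) + 1 = n + 1 + k + 1 by lia])
    exact (hS.hasProjectiveDimensionLT_X₃_iff k hP).1 h'

lemma IsSyzygy.resolves {𝒢 : ObjectProperty C} (h𝒢 : ∀ P : C, Projective P → 𝒢 P) {n k : ℕ}
    {N K : C} (h : IsSyzygy n N K) : Resolves 𝒢 k K → Resolves 𝒢 (n + k) N := by
  induction h generalizing k with
  | refl N => intro h; rwa [zero_add]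
  | @step n N K P K' f g w hS hP _ ih =>
    intro h
    rw [show n + 1 + k = n + (k + 1) by lia]
    exact ih (.succ hS (h𝒢 P hP) h)

lemma exists_isSyzygy [EnoughProjectives C] (n : ℕ) (N : C) : ∃ K, IsSyzygy n N K := by
  induction n with
  | zero => exact ⟨N, .refl N⟩
  | succ n ih =>
    obtain ⟨K, hK⟩ := ih
    exact ⟨_, .step (f := kernel.ι (Projective.π K)) (w := kernel.condition _)
      { exact := ShortComplex.exact_kernel _ } inferInstance hK⟩

/-- Dropping the first step, the one next to `N`, rather than the last shows that the class of
`n`-th syzygies is closed under further syzygies. -/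
lemma IsSyzygy.exists_of_succ {n : ℕ} {N K : C} (h : IsSyzygy (n + 1) N K) :
    ∃ N', IsSyzygy n N' K := by
  induction n generalizing K with
  | zero => exact ⟨K, .refl K⟩
  | succ n ih =>
    cases h with
    | step hS hP h =>
      obtain ⟨N', h'⟩ := ih h
      exact ⟨N', .step hS hP h'⟩

lemma exists_isSyzygy_of_projective (n : ℕ) (P : C) (hP : Projective P) :
    ∃ N, IsSyzygy n N P := by
  obtain _ | n := n
  · exact ⟨P, .refl P⟩
  · have h0 : ∀ n, IsSyzygy n (0 : C) 0 := fun n => by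
      induction n with
      | zero => exact .refl _
      | succ n ih =>
        exact .step (f := 0) (g := (0 : (0 : C) ⟶ 0)) (w := by simp)
          (ShortComplex.ShortExact.mk' (ShortComplex.exact_of_isZero_X₂ _ (isZero_zero C))
            inferInstance inferInstance) inferInstance ih
    exact ⟨0, .step (f := 𝟙 P) (g := (0 : P ⟶ 0)) (w := by simp)
      (ShortComplex.Splitting.shortExact ⟨𝟙 P, 0, by simp, by simp, by simp⟩) hP (h0 n)⟩

/-! ### Horseshoe lemma and cosyzygies of syzygies -/

/-- One step of the horseshoe lemma, with the projective cover of the left end prescribed. -/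
lemma exists_horseshoe_step [EnoughProjectives C] {A B D K P : C} {f : A ⟶ B} {g : B ⟶ D}
    {w : f ≫ g = 0} (hS : (ShortComplex.mk f g w).ShortExact) {i : K ⟶ P} {p : P ⟶ A}
    {w' : i ≫ p = 0} (hK : (ShortComplex.mk i p w').ShortExact) (hP : Projective P) :
    ∃ (K' K'' P' P'' : C) (i' : K' ⟶ P') (p' : P' ⟶ B) (i'' : K'' ⟶ P'') (p'' : P'' ⟶ D)
      (c' : i' ≫ p' = 0) (c'' : i'' ≫ p'' = 0) (f' : K ⟶ K') (g' : K' ⟶ K'') (c : f' ≫ g' = 0),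
      Projective P' ∧ Projective P'' ∧ (ShortComplex.mk i' p' c').ShortExact ∧
      (ShortComplex.mk i'' p'' c'').ShortExact ∧ (ShortComplex.mk f' g' c).ShortExact := by
  have : Epi g := hS.epi_g
  have : Mono f := hS.mono_f
  have : Epi p := hK.epi_g
  have : Mono i := hK.mono_f
  obtain ⟨Q, q, hQ, hq⟩ : ∃ (Q : C) (q : Q ⟶ D), Projective Q ∧ Epi q :=
    ⟨_, Projective.π D, inferInstance, inferInstance⟩
  let r : Q ⟶ B := Projective.factorThru q g
  have hr : r ≫ g = q := Projective.factorThru_comp _ _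
  let p' : P ⊞ Q ⟶ B := biprod.desc (p ≫ f) r
  have hp'g : p' ≫ g = biprod.snd ≫ q := by
    apply biprod.hom_ext'
    · simp [p', w]
    · simp [p', hr]
  have : Epi p' := by
    rw [epi_iff_surjective_up_to_refinements]
    intro T y
    obtain ⟨T₁, π₁, _, y₁, h₁⟩ := surjective_up_to_refinements_of_epi q (y ≫ g)
    obtain ⟨t, ht⟩ : ∃ t, t ≫ f = π₁ ≫ y - y₁ ≫ r :=
      ⟨_, hS.exact.lift_f (π₁ ≫ y - y₁ ≫ r) (by
        dsimp only
        rw [Preadditive.sub_comp, Category.assoc, Category.assoc, hr, h₁, sub_self])⟩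
    obtain ⟨T₂, π₂, _, y₂, h₂⟩ := surjective_up_to_refinements_of_epi p t
    refine ⟨T₂, π₂ ≫ π₁, epi_comp _ _, biprod.lift y₂ (π₂ ≫ y₁), ?_⟩
    simp only [p', biprod.lift_desc]
    rw [← Category.assoc y₂, ← h₂, Category.assoc π₂ t, ht, Preadditive.comp_sub, Category.assoc,
      Category.assoc, sub_add_cancel]
  let f' : K ⟶ kernel p' := kernel.lift p' (i ≫ biprod.inl)
    (by simp only [p', Category.assoc, biprod.inl_desc]; rw [← Category.assoc, w', zero_comp])
  have hf' : f' ≫ kernel.ι p' = i ≫ biprod.inl := kernel.lift_ι _ _ _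
  let g' : kernel p' ⟶ kernel q := kernel.lift q (kernel.ι p' ≫ biprod.snd)
    (by rw [Category.assoc, ← hp'g, ← Category.assoc, kernel.condition, zero_comp])
  have hg' : g' ≫ kernel.ι q = kernel.ι p' ≫ biprod.snd := kernel.lift_ι _ _ _
  have hc : f' ≫ g' = 0 := by
    rw [← cancel_mono (kernel.ι q), Category.assoc, hg', ← Category.assoc, hf', Category.assoc,
      biprod.inl_snd, comp_zero, zero_comp]
  refine ⟨kernel p', kernel q, P ⊞ Q, Q, kernel.ι p', p', kernel.ι q, q, kernel.condition _,
    kernel.condition _, f', g', hc, inferInstance, inferInstance,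
    { exact := ShortComplex.exact_kernel _ }, { exact := ShortComplex.exact_kernel _ },
    ShortComplex.ShortExact.mk' ?_ ?_ ?_⟩
  · rw [ShortComplex.exact_iff_exact_up_to_refinements]
    intro T x hx
    dsimp only at x hx
    have h₂ : (x ≫ kernel.ι p') ≫ biprod.snd = 0 := by
      rw [Category.assoc, ← hg', ← Category.assoc, hx, zero_comp]
    have h₁ : x ≫ kernel.ι p' = (x ≫ kernel.ι p' ≫ biprod.fst) ≫ biprod.inl := by
      apply biprod.hom_ext
      · simp
      · rw [h₂]; simp
    have h₃ : (x ≫ kernel.ι p' ≫ biprod.fst) ≫ p = 0 := by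
      have h := kernel.condition p'
      rw [← cancel_mono f, zero_comp, Category.assoc]
      calc _ = ((x ≫ kernel.ι p' ≫ biprod.fst) ≫ biprod.inl) ≫ p' := by simp [p']
        _ = 0 := by rw [← h₁, Category.assoc, h, comp_zero]
    refine ⟨T, 𝟙 T, inferInstance, hK.exact.lift _ h₃, ?_⟩
    dsimp only
    rw [← cancel_mono (kernel.ι p'), Category.id_comp, Category.assoc, hf', ← Category.assoc,
      h₁]
    congr 1
    exact (hK.exact.lift_f _ h₃).symm
  · have : Mono (f' ≫ kernel.ι p') := by rw [hf']; exact mono_comp _ _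
    exact mono_of_mono _ (kernel.ι p')
  · rw [epi_iff_surjective_up_to_refinements]
    intro T y
    dsimp only at y
    have hy : (y ≫ kernel.ι q ≫ r) ≫ g = 0 := by
      rw [Category.assoc, Category.assoc, hr, kernel.condition, comp_zero]
    obtain ⟨T₁, π₁, _, s, hs⟩ := surjective_up_to_refinements_of_epi p (hS.exact.lift _ hy)
    have ht : hS.exact.lift _ hy ≫ f = y ≫ kernel.ι q ≫ r := hS.exact.lift_f _ hy
    -- An element `y` of `kernel q` is sent by `r` into the image of `A`; a preimage `s` in `P`
    -- corrects it to the element `(-s, y)` of `kernel p'`.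
    refine ⟨T₁, π₁, inferInstance, kernel.lift p' (biprod.lift (-s) (π₁ ≫ y ≫ kernel.ι q)) ?_, ?_⟩
    · simp only [p', biprod.lift_desc, Preadditive.neg_comp]
      rw [← Category.assoc s, ← hs, Category.assoc, ht]
      simp
    · dsimp only
      rw [← cancel_mono (kernel.ι q), Category.assoc, Category.assoc, hg', kernel.lift_ι_assoc,
        biprod.lift_snd]

lemma IsSyzygy.exists_horseshoe [EnoughProjectives C] {n : ℕ} {A A' : C} (h : IsSyzygy n A A')
    {B D : C} {f : A ⟶ B} {g : B ⟶ D} {w : f ≫ g = 0}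
    (hS : (ShortComplex.mk f g w).ShortExact) :
    ∃ (B' D' : C) (f' : A' ⟶ B') (g' : B' ⟶ D') (w' : f' ≫ g' = 0),
      (ShortComplex.mk f' g' w').ShortExact ∧ IsSyzygy n B B' ∧ IsSyzygy n D D' := by
  induction h with
  | refl A => exact ⟨B, D, f, g, w, hS, .refl B, .refl D⟩
  | step hK hP _ ih =>
    obtain ⟨B', D', f', g', w', hS', hB, hD⟩ := ih hS
    obtain ⟨K', K'', P', P'', i', p', i'', p'', c', c'', f'', g'', c, hP', hP'', h', h'', h⟩ :=
      exists_horseshoe_step hS' hK hP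
    exact ⟨K', K'', f'', g'', c, h, .step h' hP' hB, .step h'' hP'' hD⟩

/-- If injective objects have projective dimension at most `n`, then `n`-th syzygies embed into
projectives with an `n`-th syzygy as cokernel. -/
lemma hasProjectiveCosyzygies_isSyzygy [EnoughProjectives C] [EnoughInjectives C] {n : ℕ}
    (hI : ∀ I : C, Injective I → HasProjectiveDimensionLE I n) :
    HasProjectiveCosyzygies (fun K : C => ∃ N, IsSyzygy n N K) := by
  rintro K ⟨N, hK⟩
  have hN : (ShortComplex.mk (Injective.ι N) (cokernel.π (Injective.ι N))
    (cokernel.condition _)).ShortExact := { exact := ShortComplex.exact_cokernel _ }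
  -- Here `P` is an `n`-th syzygy of the injective hull term, whose projective dimension is at most
  -- `n`; hence `P` is projective.
  obtain ⟨P, K', f, g, w, hS, hP, hK'⟩ := hK.exists_horseshoe hN
  have : HasProjectiveDimensionLT P (0 + 1) := hP.hasProjectiveDimensionLT (hI _ inferInstance)
  exact ⟨P, K', f, g, w, hS, projective_iff_hasProjectiveDimensionLT_one.2 this, _, hK'⟩

/-! ### Gorenstein resolutions from syzygies -/

/-- Short exact sequences with projective middle term and ends in `𝒦` can be spliced into a
`ℤ`-indexed family if `𝒦` is closed under some syzygies and cosyzygies. -/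
lemma exists_family {𝒦 : ObjectProperty C} (hr : HasProjectiveCosyzygies 𝒦)
    (hl : ∀ G, 𝒦 G → ∃ (K P : C) (f : K ⟶ P) (g : P ⟶ G) (w : f ≫ g = 0),
      (ShortComplex.mk f g w).ShortExact ∧ Projective P ∧ 𝒦 K) {M : C} (hM : 𝒦 M) :
    ∃ S : ℤ → ShortComplex C, (∀ i, (S i).ShortExact ∧ Projective (S i).X₂ ∧ 𝒦 (S i).X₁ ∧
      𝒦 (S i).X₃) ∧ (∀ i, (S (i + 1)).X₃ = (S i).X₁) ∧ (S 0).X₃ = M := by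
  let T := {S : ShortComplex C // S.ShortExact ∧ Projective S.X₂ ∧ 𝒦 S.X₁ ∧ 𝒦 S.X₃}
  have exl : ∀ G, 𝒦 G → ∃ t : T, t.1.X₃ = G := fun G hG => by
    obtain ⟨K, P, f, g, w, hS, hP, hK⟩ := hl G hG
    exact ⟨⟨.mk f g w, hS, hP, hK, hG⟩, rfl⟩
  have exr : ∀ G, 𝒦 G → ∃ t : T, t.1.X₁ = G := fun G hG => by
    obtain ⟨P, K, f, g, w, hS, hP, hK⟩ := hr G hG
    exact ⟨⟨.mk f g w, hS, hP, hG, hK⟩, rfl⟩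
  obtain ⟨s, hs⟩ := exl M hM
  choose next hnext using fun t : T => exl t.1.X₁ t.2.2.2.1
  choose prev hprev using fun t : T => exr t.1.X₃ t.2.2.2.2
  -- `next` continues by a syzygy and `prev` by a cosyzygy. `Int.negSucc k` is `-(k + 1)`, hence `k
  -- + 1` iterations.
  let F : ℤ → T := fun i => match i with
    | Int.ofNat k => next^[k] s
    | Int.negSucc k => prev^[k + 1] s
  refine ⟨fun i => (F i).1, fun i => (F i).2, fun i => ?_, hs⟩
  match i with
  | Int.ofNat k =>
    change (next^[k + 1] s).1.X₃ = (next^[k] s).1.X₁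
    rw [Function.iterate_succ_apply', hnext]
  | Int.negSucc 0 => exact (hprev s).symm
  | Int.negSucc (k + 1) =>
    change (prev^[k + 1] s).1.X₃ = (prev^[k + 1 + 1] s).1.X₁
    rw [Function.iterate_succ_apply' _ (k + 1), hprev]

/-- If injective objects have projective dimension at most `n` and objects in `𝒴` have finite
injective dimension, then every object has a relative Gorenstein projective resolution of length
`n`. -/
theorem resolves_of_hasProjectiveDimensionLE [EnoughProjectives C] [EnoughInjectives C]
    {𝒴 : ObjectProperty C} {n : ℕ} (hI : ∀ I : C, Injective I → HasProjectiveDimensionLE I n)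
    (h𝒴 : ∀ Y : C, 𝒴 Y → ∃ m, HasInjectiveDimensionLT Y m) (M : C) :
    Resolves (IsRelGorensteinProjective 𝒴) n M := by
  let := HasExt.standard C
  have hr := hasProjectiveCosyzygies_isSyzygy hI
  -- The class of `n`-th syzygies has projective syzygies and cosyzygies inside itself. Any total
  -- family built from it extends maps into 𝒴, because its objects have no Ext¹ into objects of
  -- finite injective dimension.
  have key : ∀ K : C, (∃ N, IsSyzygy n N K) → IsRelGorensteinProjective 𝒴 K := by
    intro K hK
    obtain ⟨S, hS, hl, h0⟩ := exists_family hr (fun G ⟨N, hG⟩ =>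
      ⟨_, _, kernel.ι (Projective.π G), Projective.π G, kernel.condition _,
        { exact := ShortComplex.exact_kernel _ }, inferInstance,
        (IsSyzygy.step (w := kernel.condition (Projective.π G))
          { exact := ShortComplex.exact_kernel _ } inferInstance hG).exists_of_succ⟩) hK
    refine ⟨S, ⟨fun i => (hS i).1, fun i => (hS i).2.1, fun i => ⟨eqToIso (hl i)⟩, ?_⟩,
      ⟨eqToIso h0⟩⟩
    intro i Y hY a
    obtain ⟨m, hm⟩ := h𝒴 Y hY
    exact exists_extension_of_ext_eq_zero (hS i).1
      (ext_eq_zero_of_cosyzygies hr Y m _ (hS i).2.2.2 0) a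
  obtain ⟨K, hK⟩ := exists_isSyzygy n M
  exact hK.resolves (fun P hP => key P (exists_isSyzygy_of_projective n P hP))
    (.zero (key K ⟨M, hK⟩))

end Abstract

section Complexes

open ZeroObject

variable {C : Type u'} [Category.{v} C] [Abelian C]

/-! ### Acyclic complexes as spliced short exact sequences -/

/-- The opcycles at `j` are the cokernel of the differential into degree `j`, which factors through
the opcycles at `i`; exactness at `i` is exactly injectivity of the second factor. -/
lemma shortExact_opcycles {ι : Type*} {c : ComplexShape ι} (K : HomologicalComplex C c) {i j : ι}
    (hij : c.Rel i j) (hK : K.ExactAt i) :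
    (ShortComplex.mk (K.fromOpcycles i j) (K.pOpcycles j)
      (by rw [← cancel_epi (K.pOpcycles i), K.p_fromOpcycles_assoc, K.d_pOpcycles,
        comp_zero])).ShortExact := by
  refine ShortComplex.ShortExact.mk' ?_ ?_ inferInstance
  · refine ShortComplex.exact_of_g_is_cokernel _ (CokernelCofork.IsColimit.ofπ _ _
      (fun a ha => K.descOpcycles a i (c.prev_eq' hij) ?_) (fun a ha => ?_) (fun a ha b hb => ?_))
    · rw [← K.p_fromOpcycles, Category.assoc, ha, comp_zero]
    · exact K.p_descOpcycles _ _ _ _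
    · rw [← cancel_epi (K.pOpcycles j), hb, K.p_descOpcycles]
  · have h := (K.sc i).exact_iff_mono_fromOpcycles.1 hK
    obtain rfl := c.next_eq' hij
    exact h

/-- A description of a complex as a splice of short exact sequences `0 → Zᵢ₊₁ → Xᵢ → Zᵢ → 0`. -/
structure Splicing (K : ChainComplex C ℤ) where
  /-- The cycles. -/
  Z : ℤ → C
  /-- The inclusion of the cycles. -/
  ι : ∀ i, Z (i + 1) ⟶ K.X i
  /-- The projection onto the boundaries. -/
  π : ∀ i, K.X i ⟶ Z i
  w : ∀ i, ι i ≫ π i = 0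
  shortExact : ∀ i, (ShortComplex.mk (ι i) (π i) (w i)).ShortExact
  d_eq : ∀ i, K.d (i + 1) i = π (i + 1) ≫ ι i

namespace Splicing

/-- The splicing of an acyclic complex. -/
def ofAcyclic (K : ChainComplex C ℤ) (hK : K.Acyclic) : Splicing K where
  Z i := K.opcycles i
  ι i := K.fromOpcycles (i + 1) i
  π i := K.pOpcycles i
  w i := by rw [← cancel_epi (K.pOpcycles (i + 1)), K.p_fromOpcycles_assoc, K.d_pOpcycles, comp_zero]
  shortExact i := shortExact_opcycles K rfl (hK (i + 1))
  d_eq i := (K.p_fromOpcycles _ _).symm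

section Family

variable (S : ℤ → ShortComplex C) (e : ∀ i, (S (i + 1)).X₃ ≅ (S i).X₁)

/-- The complex obtained by splicing a family of short exact sequences. -/
abbrev complexOfFamily : ChainComplex C ℤ :=
  ChainComplex.of (fun i => (S i).X₂) (fun i => (S (i + 1)).g ≫ (e i).hom ≫ (S i).f)
    fun i => by simp

/-- The tautological splicing of `complexOfFamily`. -/
def ofFamily (hS : ∀ i, (S i).ShortExact) : Splicing (complexOfFamily S e) where
  Z i := (S i).X₃
  ι i := (e i).hom ≫ (S i).f
  π i := (S i).g
  w i := (Category.assoc _ _ _).trans (by rw [(S i).zero, comp_zero])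
  shortExact i := shortExact_of_iso_left (hS i) (e i)
  d_eq i := ChainComplex.of_d (fun i => (S i).X₂) (fun i => (S (i + 1)).g ≫ (e i).hom ≫ (S i).f) i

end Family

variable {K : ChainComplex C ℤ} (s : Splicing K)

instance (i : ℤ) : Mono (s.ι i) := (s.shortExact i).mono_f

instance (i : ℤ) : Epi (s.π i) := (s.shortExact i).epi_g

include s in
lemma acyclic : K.Acyclic := by
  intro i
  obtain ⟨j, rfl⟩ : ∃ j, i = j + 1 := ⟨i - 1, by simp⟩
  rw [HomologicalComplex.exactAt_iff' _ (j + 1 + 1) (j + 1) j (by simp) (by simp)]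
  have w : s.ι (j + 1) ≫ s.π (j + 1) ≫ s.ι j = 0 := by rw [reassoc_of% s.w, zero_comp]
  -- Exactness is unaffected by precomposing the first map with the epimorphism `π` (through `φ`)
  -- and by postcomposing the second with the monomorphism `ι` (through `ψ`).
  let φ : K.sc' (j + 1 + 1) (j + 1) j ⟶ ShortComplex.mk (s.ι (j + 1)) (s.π (j + 1) ≫ s.ι j) w :=
    { τ₁ := s.π (j + 1 + 1)
      τ₂ := 𝟙 (K.X (j + 1))
      τ₃ := 𝟙 (K.X j)
      comm₁₂ := (s.d_eq (j + 1)).symm.trans (Category.comp_id _).symm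
      comm₂₃ := (Category.id_comp _).trans ((s.d_eq j).symm.trans (Category.comp_id _).symm) }
  let ψ : ShortComplex.mk (s.ι (j + 1)) (s.π (j + 1)) (s.w _) ⟶
      ShortComplex.mk (s.ι (j + 1)) (s.π (j + 1) ≫ s.ι j) w :=
    { τ₁ := 𝟙 _, τ₂ := 𝟙 _, τ₃ := s.ι j }
  have : Epi φ.τ₁ := inferInstanceAs (Epi (s.π (j + 1 + 1)))
  have : IsIso φ.τ₂ := inferInstanceAs (IsIso (𝟙 (K.X (j + 1))))
  have : Mono φ.τ₃ := inferInstanceAs (Mono (𝟙 (K.X j)))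
  have : Epi ψ.τ₁ := inferInstanceAs (Epi (𝟙 (s.Z (j + 1 + 1))))
  have : IsIso ψ.τ₂ := inferInstanceAs (IsIso (𝟙 (K.X (j + 1))))
  have : Mono ψ.τ₃ := inferInstanceAs (Mono (s.ι j))
  exact (ShortComplex.exact_iff_of_epi_of_isIso_of_mono φ).2
    ((ShortComplex.exact_iff_of_epi_of_isIso_of_mono ψ).1 (s.shortExact (j + 1)).exact)

/-- The cokernel of a differential of a spliced complex. -/
def cokernelIso (i : ℤ) : s.Z i ≅ cokernel (K.d (i + 1) i) := by
  refine IsColimit.coconePointUniqueUpToIso (CokernelCofork.IsColimit.ofπ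
    (f := K.d (i + 1) i) (s.π i) ?_
    (fun a ha => (s.shortExact i).gIsCokernel.desc (CokernelCofork.ofπ a ?_)) (fun a ha => ?_)
    (fun a ha b hb => ?_)) (colimit.isColimit _)
  · rw [s.d_eq, Category.assoc, s.w, comp_zero]
  · rwa [s.d_eq, Category.assoc, ← comp_zero (f := s.π (i + 1)), cancel_epi] at ha
  · exact Cofork.IsColimit.π_desc (s.shortExact i).gIsCokernel
  · rw [← cancel_epi (s.π i), hb]
    exact (Cofork.IsColimit.π_desc (s.shortExact i).gIsCokernel (t := CokernelCofork.ofπ a _)).symm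

/-- A map `X_{i+1} ⟶ Y` killed by the incoming differential is the same as a map from the cycles `Z
(i + 1)`, and it comes from `X_i` iff the latter extends along `ι i`. -/
lemma exact_hom_to_iff {Y : C} :
    (∀ i : ℤ, Function.Exact (fun g : K.X (i - 1) ⟶ Y => K.d i (i - 1) ≫ g)
      (fun g : K.X i ⟶ Y => K.d (i + 1) i ≫ g)) ↔
    ∀ i (a : s.Z (i + 1) ⟶ Y), ∃ b, s.ι i ≫ b = a := by
  constructor
  · intro h i a
    have h := h (i + 1)
    rw [add_sub_cancel_right] at h
    obtain ⟨b, hb⟩ := (h (s.π (i + 1) ≫ a)).1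
      (by dsimp only; rw [s.d_eq, Category.assoc, reassoc_of% s.w, zero_comp, comp_zero])
    refine ⟨b, ?_⟩
    dsimp only at hb
    rwa [s.d_eq, Category.assoc, cancel_epi] at hb
  · intro h i
    obtain ⟨j, rfl⟩ : ∃ j, i = j + 1 := ⟨i - 1, by simp⟩
    rw [add_sub_cancel_right]
    intro g
    refine ⟨fun hg => ?_, ?_⟩
    · dsimp only at hg
      rw [s.d_eq, Category.assoc, ← comp_zero (f := s.π (j + 1 + 1)), cancel_epi] at hg
      obtain ⟨b, hb⟩ := h j ((s.shortExact (j + 1)).exact.desc g hg)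
      refine ⟨b, ?_⟩
      dsimp only
      rw [s.d_eq, Category.assoc, hb]
      exact (s.shortExact (j + 1)).exact.g_desc g hg
    · rintro ⟨a, rfl⟩
      dsimp only
      rw [← Category.assoc, K.d_comp_d, zero_comp]

lemma exact_hom_from_iff {X : C} :
    (∀ i : ℤ, Function.Exact (fun g : X ⟶ K.X (i + 1) => g ≫ K.d (i + 1) i)
      (fun g : X ⟶ K.X i => g ≫ K.d i (i - 1))) ↔
    ∀ i (a : X ⟶ s.Z i), ∃ b, b ≫ s.π i = a := by
  constructor
  · intro h i a
    obtain ⟨j, rfl⟩ : ∃ j, i = j + 1 := ⟨i - 1, by simp⟩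
    obtain ⟨k, rfl⟩ : ∃ k, j = k + 1 := ⟨j - 1, by simp⟩
    have h := h (k + 1)
    rw [add_sub_cancel_right] at h
    obtain ⟨b, hb⟩ := (h (a ≫ s.ι (k + 1))).1
      (by dsimp only; rw [s.d_eq, Category.assoc, reassoc_of% s.w, zero_comp, comp_zero])
    refine ⟨b, ?_⟩
    dsimp only at hb
    rwa [s.d_eq, ← Category.assoc, cancel_mono] at hb
  · intro h i
    obtain ⟨j, rfl⟩ : ∃ j, i = j + 1 := ⟨i - 1, by simp⟩
    rw [add_sub_cancel_right]
    intro g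
    refine ⟨fun hg => ?_, ?_⟩
    · dsimp only at hg
      rw [s.d_eq, ← Category.assoc, ← zero_comp (f := s.ι j), cancel_mono] at hg
      obtain ⟨b, hb⟩ := h (j + 1 + 1) ((s.shortExact (j + 1)).exact.lift g hg)
      refine ⟨b, ?_⟩
      dsimp only
      rw [s.d_eq, reassoc_of% hb]
      exact (s.shortExact (j + 1)).exact.lift_f g hg
    · rintro ⟨a, rfl⟩
      dsimp only
      rw [Category.assoc, K.d_comp_d, comp_zero]

end Splicing

/-! ### Bounded resolutions -/

/-- `HasResolutionOfLength` in an arbitrary abelian category. -/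
def HasBoundedResolution (𝒢 : ObjectProperty C) (n : ℕ) (M : C) : Prop :=
  ∃ G : ChainComplex C ℕ, G.Acyclic ∧ Nonempty (G.X 0 ≅ M) ∧
    (∀ i ≤ n, 𝒢 (G.X (i + 1))) ∧ ∀ i > n, IsZero (G.X (i + 1))

lemma HasBoundedResolution.resolves {𝒢 : ObjectProperty C} [𝒢.IsClosedUnderIsomorphisms] {n : ℕ}
    {M : C} (h : HasBoundedResolution 𝒢 n M) : Resolves 𝒢 n M := by
  obtain ⟨G, hG, ⟨e⟩, h𝒢, h0⟩ := h
  have hS : ∀ k, (ShortComplex.mk (G.fromOpcycles (k + 1) k) (G.pOpcycles k) _).ShortExact :=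
    fun k => shortExact_opcycles G rfl (hG (k + 1))
  -- As `M` itself sits in degree `0`, it is identified below with the opcycles in degree `1`; the
  -- induction runs downwards from degree `n + 1`, where the opcycles are the last nonzero term.
  have key : ∀ j k, k + j = n → Resolves 𝒢 j (G.opcycles (k + 1)) := by
    intro j
    induction j with
    | zero =>
      rintro k rfl
      have hz : IsZero (G.opcycles (k + 1 + 1)) :=
        IsZero.of_epi (G.pOpcycles (k + 1 + 1)) (h0 (k + 1) (by simp))
      have : IsIso (G.pOpcycles (k + 1)) := by
        have : Mono (G.pOpcycles (k + 1)) :=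
          (hS (k + 1)).exact.mono_g (hz.eq_of_src _ _)
        exact isIso_of_mono_of_epi _
      exact .zero (𝒢.prop_of_iso (asIso (G.pOpcycles (k + 1))) (h𝒢 k (by simp)))
    | succ j ih =>
      intro k hk
      exact .succ (hS (k + 1)) (h𝒢 k (by lia)) (ih (k + 1) (by lia))
  have : Epi (G.d 1 0) := by
    have := hG 0
    rw [HomologicalComplex.exactAt_iff' _ 1 0 0 (by simp) (by simp)] at this
    exact this.epi_f (G.shape _ _ (by simp))
  have : IsIso (G.fromOpcycles 1 0) := by
    have : Mono (G.fromOpcycles 1 0) := (hS 0).mono_f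
    have : Epi (G.pOpcycles 1 ≫ G.fromOpcycles 1 0) := by rwa [G.p_fromOpcycles]
    have : Epi (G.fromOpcycles 1 0) := epi_of_epi (G.pOpcycles 1) _
    exact isIso_of_mono_of_epi _
  have e' : G.opcycles 1 ≅ M := asIso (G.fromOpcycles 1 0) ≪≫ e
  have h := key n 0 (zero_add n)
  cases h with
  | zero h => exact .zero (𝒢.prop_of_iso e' h)
  | succ hS hG hK => exact .succ (shortExact_of_iso_right hS e') hG hK

/-- Splices a resolution of `K` onto the short exact sequence: the term `K` in degree `0` is
truncated away and the rest augmented by `P`, then by `M`, so that degrees rise by one overall. -/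
lemma exists_acyclic_extension {K P M : C} {f : K ⟶ P} {g : P ⟶ M} {w : f ≫ g = 0}
    (hS : (ShortComplex.mk f g w).ShortExact) (G : ChainComplex C ℕ) (hG : G.Acyclic)
    (e : G.X 0 ≅ K) :
    ∃ G' : ChainComplex C ℕ, G'.Acyclic ∧ G'.X 0 = M ∧ G'.X 1 = P ∧
      ∀ i, G'.X (i + 2) = G.X (i + 1) := by
  have : Epi g := hS.epi_g
  have : Mono f := hS.mono_f
  let G₁ : ChainComplex C ℕ := (ChainComplex.truncate.obj G).augment (G.d 1 0 ≫ e.hom ≫ f)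
    ((G.d_comp_d_assoc 2 1 0 _).trans zero_comp)
  let G' : ChainComplex C ℕ := G₁.augment g (by
    change (G.d 1 0 ≫ e.hom ≫ f) ≫ g = 0
    simp [w])
  refine ⟨G', fun i => ?_, rfl, rfl, fun i => rfl⟩
  match i with
  | 0 =>
    rw [HomologicalComplex.exactAt_iff' _ 1 0 0 (by simp) (by simp)]
    rw [ShortComplex.exact_iff_epi _ (G'.shape 0 0 (by simp))]
    exact hS.epi_g
  | 1 =>
    rw [HomologicalComplex.exactAt_iff' _ 2 1 0 (by simp) (by simp)]
    have : Epi (G.d 1 0) := by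
      have := hG 0
      rw [HomologicalComplex.exactAt_iff' _ 1 0 0 (by simp) (by simp)] at this
      exact this.epi_f (G.shape _ _ (by simp))
    let φ : G'.sc' 2 1 0 ⟶ ShortComplex.mk f g w :=
      { τ₁ := G.d 1 0 ≫ e.hom
        τ₂ := 𝟙 P
        τ₃ := 𝟙 M
        comm₁₂ := (Category.assoc _ _ _).trans (Category.comp_id _).symm
        comm₂₃ := (Category.id_comp _).trans (Category.comp_id _).symm }
    have : Epi φ.τ₁ := epi_comp (G.d 1 0) e.hom
    have : IsIso φ.τ₂ := inferInstanceAs (IsIso (𝟙 P))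
    have : Mono φ.τ₃ := inferInstanceAs (Mono (𝟙 M))
    exact (ShortComplex.exact_iff_of_epi_of_isIso_of_mono φ).2 hS.exact
  | 2 =>
    rw [HomologicalComplex.exactAt_iff' _ 3 2 1 (by simp) (by simp)]
    have h := hG 1
    rw [HomologicalComplex.exactAt_iff' _ 2 1 0 (by simp) (by simp)] at h
    let φ : G.sc' 2 1 0 ⟶ G'.sc' 3 2 1 :=
      { τ₁ := 𝟙 _
        τ₂ := 𝟙 _
        τ₃ := e.hom ≫ f
        comm₁₂ := (Category.id_comp _).trans (Category.comp_id _).symm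
        comm₂₃ := Category.id_comp _ }
    have : Epi φ.τ₁ := inferInstanceAs (Epi (𝟙 (G.X 2)))
    have : IsIso φ.τ₂ := inferInstanceAs (IsIso (𝟙 (G.X 1)))
    have : Mono φ.τ₃ := mono_comp e.hom f
    exact (ShortComplex.exact_iff_of_epi_of_isIso_of_mono φ).1 h
  | k + 3 =>
    rw [HomologicalComplex.exactAt_iff' _ (k + 4) (k + 3) (k + 2) (by simp) (by simp)]
    have h := hG (k + 2)
    rw [HomologicalComplex.exactAt_iff' _ (k + 3) (k + 2) (k + 1) (by simp) (by simp)] at h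
    exact h

lemma Resolves.hasBoundedResolution {𝒢 : ObjectProperty C} {n : ℕ} {M : C}
    (h : Resolves 𝒢 n M) : HasBoundedResolution 𝒢 n M := by
  induction h with
  | @zero M hM =>
    have hS : (ShortComplex.mk (0 : (0 : C) ⟶ M) (𝟙 M) zero_comp).ShortExact :=
      ShortComplex.Splitting.shortExact ⟨0, 𝟙 M, by simp, by simp, by simp⟩
    have h0 (i : ℕ) : IsZero ((0 : ChainComplex C ℕ).X i) :=
      (HomologicalComplex.eval C _ i).map_isZero (isZero_zero _)
    obtain ⟨G, hG, h₀, h₁, h₂⟩ := exists_acyclic_extension hS (0 : ChainComplex C ℕ)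
      (HomologicalComplex.acyclic_of_isZero _ (isZero_zero _)) ((h0 0).iso (isZero_zero C))
    refine ⟨G, hG, ⟨eqToIso h₀⟩, fun i hi => ?_, fun i hi => ?_⟩
    · obtain rfl : i = 0 := by lia
      rwa [h₁]
    · obtain ⟨j, rfl⟩ : ∃ j, i = j + 1 := ⟨i - 1, by lia⟩
      rw [h₂]
      exact h0 _
  | @succ n K P M f g w hS hP _ ih =>
    obtain ⟨G, hG, ⟨e⟩, h𝒢, hz⟩ := ih
    obtain ⟨G', hG', h₀, h₁, h₂⟩ := exists_acyclic_extension hS G hG e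
    refine ⟨G', hG', ⟨eqToIso h₀⟩, fun i hi => ?_, fun i hi => ?_⟩
    · obtain _ | i := i
      · rwa [h₁]
      · rw [h₂]
        exact h𝒢 i (by lia)
    · obtain ⟨j, rfl⟩ : ∃ j, i = j + 1 := ⟨i - 1, by lia⟩
      rw [h₂]
      exact hz j (by lia)

lemma hasBoundedResolution_op_iff {𝒢 : ObjectProperty C} {n : ℕ} {M : C} :
    HasBoundedResolution 𝒢.op n (Opposite.op M) ↔
      ∃ G : CochainComplex C ℕ, G.Acyclic ∧ Nonempty (G.X 0 ≅ M) ∧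
        (∀ i ≤ n, 𝒢 (G.X (i + 1))) ∧ ∀ i > n, IsZero (G.X (i + 1)) := by
  constructor
  · rintro ⟨G, hG, ⟨e⟩, h𝒢, hz⟩
    exact ⟨HomologicalComplex.unop G, hG.unop, ⟨e.unop.symm⟩, h𝒢, fun i hi => (hz i hi).unop⟩
  · rintro ⟨G, hG, ⟨e⟩, h𝒢, hz⟩
    exact ⟨HomologicalComplex.op G, hG.op, ⟨e.op.symm⟩, h𝒢, fun i hi => (hz i hi).op⟩

end Complexes

/-! ### Duality for dimensions -/

section Duality

variable {C : Type u'} [Category.{v} C] [Abelian C]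

open Opposite

/-- Dimension shifting along an embedding into an injective, whose opposite is a projective
presentation. The case `n = 0` is apart, as it means that `X` is zero. -/
lemma hasProjectiveDimensionLT_op [EnoughInjectives C] {n : ℕ} {X : C}
    (h : HasInjectiveDimensionLT X n) : HasProjectiveDimensionLT (op X) n := by
  obtain _ | n := n
  · exact (isZero_of_hasInjectiveDimensionLT_zero X).op.hasProjectiveDimensionLT_zero
  induction n generalizing X with
  | zero =>
    have : Injective X := injective_iff_hasInjectiveDimensionLT_one.2 h
    have := Injective.injective_iff_projective_op.1 this
    exact projective_iff_hasProjectiveDimensionLT_one.1 this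
  | succ n ih =>
    have hS : (ShortComplex.mk (Injective.ι X) (cokernel.π (Injective.ι X))
      (cokernel.condition _)).ShortExact := { exact := ShortComplex.exact_cokernel _ }
    have h' := ih ((hS.hasInjectiveDimensionLT_X₃_iff n inferInstance).2 h)
    exact (hS.op.hasProjectiveDimensionLT_X₃_iff n
      (Injective.injective_iff_projective_op.1 inferInstance)).2 h'

lemma hasInjectiveDimensionLT_op [EnoughProjectives C] {n : ℕ} {X : C}
    (h : HasProjectiveDimensionLT X n) : HasInjectiveDimensionLT (op X) n := by
  obtain _ | n := n
  · exact (isZero_of_hasProjectiveDimensionLT_zero X).op.hasInjectiveDimensionLT_zero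
  induction n generalizing X with
  | zero =>
    have : Projective X := projective_iff_hasProjectiveDimensionLT_one.2 h
    have := Injective.projective_iff_injective_op.1 this
    exact injective_iff_hasInjectiveDimensionLT_one.1 this
  | succ n ih =>
    have hS : (ShortComplex.mk (kernel.ι (Projective.π X)) (Projective.π X)
      (kernel.condition _)).ShortExact := { exact := ShortComplex.exact_kernel _ }
    have h' := ih ((hS.hasProjectiveDimensionLT_X₃_iff n inferInstance).1 h)
    exact (hS.op.hasInjectiveDimensionLT_X₃_iff n
      (Injective.projective_iff_injective_op.1 inferInstance)).1 h'

lemma hasInjectiveDimensionLT_of_op [EnoughInjectives C] {n : ℕ} {X : C}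
    (h : HasProjectiveDimensionLT (op X) n) : HasInjectiveDimensionLT X n := by
  obtain _ | n := n
  · exact (isZero_of_hasProjectiveDimensionLT_zero (op X)).unop.hasInjectiveDimensionLT_zero
  induction n generalizing X with
  | zero =>
    have : Projective (op X) := projective_iff_hasProjectiveDimensionLT_one.2 h
    have := Injective.injective_iff_projective_op.2 this
    exact injective_iff_hasInjectiveDimensionLT_one.1 this
  | succ n ih =>
    have hS : (ShortComplex.mk (Injective.ι X) (cokernel.π (Injective.ι X))
      (cokernel.condition _)).ShortExact := { exact := ShortComplex.exact_cokernel _ }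
    exact (hS.hasInjectiveDimensionLT_X₃_iff n inferInstance).1 (ih
      ((hS.op.hasProjectiveDimensionLT_X₃_iff n
        (Injective.injective_iff_projective_op.1 inferInstance)).1 h))

lemma hasProjectiveDimensionLT_of_op [EnoughProjectives C] {n : ℕ} {X : C}
    (h : HasInjectiveDimensionLT (op X) n) : HasProjectiveDimensionLT X n := by
  obtain _ | n := n
  · exact (isZero_of_hasInjectiveDimensionLT_zero (op X)).unop.hasProjectiveDimensionLT_zero
  induction n generalizing X with
  | zero =>
    have : Injective (op X) := injective_iff_hasInjectiveDimensionLT_one.2 h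
    have := Injective.projective_iff_injective_op.2 this
    exact projective_iff_hasProjectiveDimensionLT_one.1 this
  | succ n ih =>
    have hS : (ShortComplex.mk (kernel.ι (Projective.π X)) (Projective.π X)
      (kernel.condition _)).ShortExact := { exact := ShortComplex.exact_kernel _ }
    exact (hS.hasProjectiveDimensionLT_X₃_iff n inferInstance).2 (ih
      ((hS.op.hasInjectiveDimensionLT_X₃_iff n
        (Injective.projective_iff_injective_op.1 inferInstance)).2 h))

end Duality

/-! ### Projective modules are level -/

section Level

variable {R : Type u} [Ring R]

/-- The biadditive map `N × L → N^(ι)` induced by a linear map `L → R^(ι)`. -/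
def coordBilin (N : ModuleCat.{u} Rᵐᵒᵖ) {L : ModuleCat.{u} R} {ι : Type*} (s : L →ₗ[R] ι →₀ R) :
    N →ₗ[ℤ] L →ₗ[ℤ] ι →₀ N :=
  LinearMap.mk₂ ℤ
    (fun (n : N) (l : L) => (s l).mapRange (fun r => MulOpposite.op r • n) (by simp))
    (fun m n l => by ext i; simp) (fun c n l => by ext i; exact smul_comm _ c n)
    (fun n l l' => by ext i; simp [add_smul]) (fun c n l => by
      ext i
      rw [map_zsmul]
      simp only [Finsupp.mapRange_apply, Finsupp.smul_apply, MulOpposite.op_smul, smul_assoc])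

/-- The map `N ⊗_R L → N^(ι)` induced by a linear map `L → R^(ι)`. -/
def balancedCoord (N : ModuleCat.{u} Rᵐᵒᵖ) {L : ModuleCat.{u} R} {ι : Type*} (s : L →ₗ[R] ι →₀ R) :
    BalancedTensor N L →ₗ[ℤ] ι →₀ N :=
  (balancedRelations N L).liftQ (TensorProduct.lift (coordBilin N s)) (by
    refine Submodule.span_le.2 ?_
    rintro _ ⟨n, r, l, rfl⟩
    refine LinearMap.mem_ker.2 ((map_sub (TensorProduct.lift (coordBilin N s)) _ _).trans
      (sub_eq_zero.2 ?_))
    ext i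
    simp [coordBilin, mul_smul])

/-- The map `N^(L) → N ⊗_R L` sending the element `n` in position `l` to `n ⊗ l`. -/
def balancedSum (N : ModuleCat.{u} Rᵐᵒᵖ) (L : ModuleCat.{u} R) :
    (L →₀ N) →+ BalancedTensor N L :=
  Finsupp.liftAddHom fun l => AddMonoidHom.mk' (fun n => Submodule.Quotient.mk (n ⊗ₜ[ℤ] l))
    fun a b => by rw [TensorProduct.add_tmul, Submodule.Quotient.mk_add]

lemma balancedSum_single (N : ModuleCat.{u} Rᵐᵒᵖ) (L : ModuleCat.{u} R) (l : L) (n : N) :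
    balancedSum N L (Finsupp.single l n) = Submodule.Quotient.mk (n ⊗ₜ[ℤ] l) := by
  simp [balancedSum]

lemma balancedMap_balancedSum {N N' : ModuleCat.{u} Rᵐᵒᵖ} (f : N ⟶ N') (L : ModuleCat.{u} R)
    (x : L →₀ N) :
    balancedMap f L (balancedSum N L x) = balancedSum N' L (x.mapRange f.hom (map_zero _)) := by
  induction x using Finsupp.induction_linear with
  | zero => simp
  | add x y hx hy =>
    rw [map_add, map_add, hx, hy, Finsupp.mapRange_add (fun a b => map_add f.hom a b), map_add]
  | single l n =>
    rw [balancedSum_single, balancedMap_mk_tmul, Finsupp.mapRange_single, balancedSum_single]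

lemma balancedCoord_balancedMap {N N' : ModuleCat.{u} Rᵐᵒᵖ} (f : N ⟶ N') {L : ModuleCat.{u} R}
    {ι : Type*} (s : L →ₗ[R] ι →₀ R) (x : BalancedTensor N L) (i : ι) :
    balancedCoord N' s (balancedMap f L x) i = f.hom (balancedCoord N s x i) := by
  have := balancedTensor_hom_ext
    (g := (Finsupp.lapply i) ∘ₗ balancedCoord N' s ∘ₗ balancedMap f L)
    (h := f.hom.toAddMonoidHom.toIntLinearMap ∘ₗ (Finsupp.lapply i) ∘ₗ balancedCoord N s)
    fun n l => (map_smul f.hom (MulOpposite.op (s l i)) n).symm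
  exact LinearMap.congr_fun this x

lemma mk_smul_tmul {N : ModuleCat.{u} Rᵐᵒᵖ} {L : ModuleCat.{u} R} (n : N) (r : R) (l : L) :
    (Submodule.Quotient.mk ((MulOpposite.op r • n) ⊗ₜ[ℤ] l) : BalancedTensor N L) =
      Submodule.Quotient.mk (n ⊗ₜ[ℤ] (r • l)) :=
  (Submodule.Quotient.eq _).2 (Submodule.subset_span ⟨n, r, l, rfl⟩)

/-- The dual basis identity `l = ∑ s(l)ᵢ • i`, moved across the tensor sign. It makes `N ⊗_R L` a
retract of a direct sum of copies of `N`, naturally in `N`, so exactness passes to the tensor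
product. -/
lemma balancedSum_balancedCoord {N : ModuleCat.{u} Rᵐᵒᵖ} {L : ModuleCat.{u} R}
    {s : L →ₗ[R] L →₀ R} (hs : Finsupp.linearCombination R id ∘ₗ s = LinearMap.id)
    (x : BalancedTensor N L) : balancedSum N L (balancedCoord N s x) = x := by
  refine LinearMap.congr_fun (balancedTensor_hom_ext
    (g := (balancedSum N L).toIntLinearMap ∘ₗ balancedCoord N s) (h := LinearMap.id) fun n l => ?_) x
  have key : ∀ y : L →₀ R, balancedSum N L (y.mapRange (fun r => MulOpposite.op r • n) (by simp)) =
      Submodule.Quotient.mk (n ⊗ₜ[ℤ] (Finsupp.linearCombination R id y)) := by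
    intro y
    induction y using Finsupp.induction_linear with
    | zero => simp
    | add y z hy hz =>
      rw [Finsupp.mapRange_add (fun a b => by rw [MulOpposite.op_add, add_smul]), map_add, hy, hz,
        map_add, TensorProduct.tmul_add, Submodule.Quotient.mk_add]
    | single l r =>
      rw [Finsupp.mapRange_single, balancedSum_single, mk_smul_tmul,
        Finsupp.linearCombination_single, id]
  exact (key (s l)).trans (by rw [← LinearMap.comp_apply, hs]; rfl)

lemma balancedMap_exact {N₁ N₂ N₃ : ModuleCat.{u} Rᵐᵒᵖ} {f : N₁ ⟶ N₂} {g : N₂ ⟶ N₃}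
    (h : Function.Exact f.hom g.hom) (L : ModuleCat.{u} R) [Projective L] :
    Function.Exact (balancedMap f L) (balancedMap g L) := by
  have : Module.Projective R L := (IsProjective.iff_projective (R := R) (P := L)).2 inferInstance
  obtain ⟨s, hs⟩ := Module.projective_def'.1 this
  intro x
  constructor
  · intro hx
    choose! c hc using fun n (hn : g.hom n = 0) => (h n).1 hn
    have hx' (i : L) : g.hom (balancedCoord N₂ s x i) = 0 := by
      rw [← balancedCoord_balancedMap, hx, map_zero, Finsupp.zero_apply]
    classical
    -- Preimages are chosen coordinatewise; zero must go to zero to keep the support finite.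
    refine ⟨balancedSum N₁ L ((balancedCoord N₂ s x).mapRange
      (fun n => if n = 0 then 0 else c n) (by simp)), ?_⟩
    rw [balancedMap_balancedSum]
    conv_rhs => rw [← balancedSum_balancedCoord hs x]
    congr 1
    ext i
    rw [Finsupp.mapRange_apply, Finsupp.mapRange_apply]
    split_ifs with h0
    · rw [h0, map_zero]
    · exact hc _ (hx' i)
  · rintro ⟨y, rfl⟩
    rw [← LinearMap.comp_apply, ← balancedMap_comp]
    have h0 : f ≫ g = 0 := by
      ext n
      exact (h _).2 ⟨n, rfl⟩
    rw [h0, show balancedMap (0 : N₁ ⟶ N₃) L = 0 from balancedTensor_hom_ext fun n l => by simp]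
    rfl

lemma isLevel_of_projective (L : ModuleCat.{u} R) [Projective L] : IsLevel L := by
  rintro F ⟨P, -⟩
  refine IsZero.of_iso ?_ (P.isoLeftDerivedObj (tensorFunctor L) 1)
  change IsZero (((tensorFunctor L).mapHomologicalComplex _).obj P.complex |>.homology 1)
  rw [← HomologicalComplex.exactAt_iff_isZero_homology,
    HomologicalComplex.exactAt_iff' _ 2 1 0 (by simp) (by simp),
    ShortComplex.ShortExact.moduleCat_exact_iff_function_exact]
  have h := P.complex_exactAt_succ 0
  rw [HomologicalComplex.exactAt_iff' _ 2 1 0 (by simp) (by simp),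
    ShortComplex.ShortExact.moduleCat_exact_iff_function_exact] at h
  exact balancedMap_exact h L

lemma isAbsolutelyClean_of_injective (I : ModuleCat.{u} R) [Injective I] :
    IsAbsolutelyClean I :=
  fun F _ => HasInjectiveDimensionLT.subsingleton I 1 1 le_rfl F

end Level

/-! ### Complete resolutions of modules -/

section CompleteResolutions

variable {R : Type u} [Ring R]

open Opposite

lemma hasCompleteProjRes_iff {𝒴 : ObjectProperty (ModuleCat.{u} R)} {M : ModuleCat.{u} R} :
    HasCompleteProjRes 𝒴 M ↔ IsRelGorensteinProjective 𝒴 M := by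
  constructor
  · rintro ⟨K, hP, hK, ⟨e⟩, h⟩
    let s := Splicing.ofAcyclic K hK
    exact ⟨fun i => .mk (s.ι i) (s.π i) (s.w i), ⟨s.shortExact, hP, fun i => ⟨Iso.refl _⟩,
      fun i Y hY => s.exact_hom_to_iff.1 (h Y hY) i⟩, ⟨s.cokernelIso 0 ≪≫ e.symm⟩⟩
  · rintro ⟨S, hS, ⟨e⟩⟩
    let l := fun i => (hS.link i).some
    let s := Splicing.ofFamily S l hS.shortExact
    refine ⟨_, hS.projective, s.acyclic, ⟨e.symm ≪≫ s.cokernelIso 0⟩, fun Y hY =>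
      s.exact_hom_to_iff.2 fun i (a : (S (i + 1)).X₃ ⟶ Y) => ?_⟩
    obtain ⟨b, hb⟩ := hS.extend i Y hY ((l i).inv ≫ a)
    exact ⟨b, (Category.assoc _ _ _).trans ((congrArg ((l i).hom ≫ ·) hb).trans
      (Iso.hom_inv_id_assoc (l i) a))⟩

lemma hasCompleteInjRes_iff {𝒳 : ObjectProperty (ModuleCat.{u} R)} {M : ModuleCat.{u} R} :
    HasCompleteInjRes 𝒳 M ↔ IsRelGorensteinProjective 𝒳.op (op M) := by
  constructor
  · rintro ⟨K, hI, hK, ⟨e⟩, h⟩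
    let s := Splicing.ofAcyclic K hK
    -- Passing to the opposite swaps the ends of each sequence, so the right end at `i` is `Z (-1 -
    -- i + 1)`; reflecting by `-1 - i` rather than `-i` puts `Z 0` at index `0`.
    refine ⟨fun i => (ShortComplex.mk (s.ι (-1 - i)) (s.π (-1 - i)) (s.w _)).op,
      ⟨fun i => (s.shortExact _).op, fun i => Injective.injective_iff_projective_op.1 (hI _),
        fun i => ⟨eqToIso (congrArg (fun j => op (s.Z j)) (by ring))⟩, fun i Y hY a => ?_⟩,
      ⟨(e ≪≫ (s.cokernelIso 0).symm).op⟩⟩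
    obtain ⟨b, hb⟩ := s.exact_hom_from_iff.1 (h Y.unop hY) (-1 - i) a.unop
    exact ⟨b.op, Quiver.Hom.unop_inj hb⟩
  · rintro ⟨S, hS, ⟨e⟩⟩
    let l := fun i => (hS.link i).some
    let T : ℤ → ShortComplex (ModuleCat.{u} R) := fun i => (S (-1 - i)).unop
    have hT : ∀ i, (T i).ShortExact := fun i => (hS.shortExact _).unop
    let l' : ∀ i, (T (i + 1)).X₃ ≅ (T i).X₁ := fun i =>
      (eqToIso (congrArg (fun j => (S j).X₃) (by ring)) ≪≫ l (-1 - (i + 1))).unop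
    let s := Splicing.ofFamily T l' hT
    let l₀ : (S 0).X₃ ≅ (S (-1)).X₁ :=
      eqToIso (congrArg (fun j => (S j).X₃) (by ring)) ≪≫ l (-1)
    have e' : M ≅ s.Z 0 := (l₀.symm ≪≫ e).unop
    refine ⟨_, fun i => Injective.injective_iff_projective_op.2 (hS.projective (-1 - i)),
      s.acyclic, ⟨e' ≪≫ s.cokernelIso 0⟩, fun X hX => s.exact_hom_from_iff.2 fun i a => ?_⟩
    obtain ⟨b, hb⟩ := hS.extend (-1 - i) (op X) hX a.op
    exact ⟨b.unop, Quiver.Hom.op_inj hb⟩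

end CompleteResolutions

/-! ### Comparison of global dimensions -/

section GlobalDimensions


variable {C : Type u'} [Category.{v} C] [Abelian C]

open Opposite

instance (𝒴 : ObjectProperty C) :
    (IsRelGorensteinProjective 𝒴).IsClosedUnderIsomorphisms where
  of_iso e h := h.of_iso e

lemma iInf_natCast_le_iff (p : ℕ → Prop) (n : ℕ) :
    (⨅ (k : ℕ) (_ : p k), (k : ℕ∞)) ≤ n ↔ ∃ k ≤ n, p k := by
  refine ⟨fun h => ?_, fun ⟨k, hk, hp⟩ => iInf₂_le_of_le k hp (by exact_mod_cast hk)⟩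
  by_contra! hc
  have : ((n + 1 : ℕ) : ℕ∞) ≤ n :=
    (le_iInf₂ fun k hp => by
      have : n < k := by
        by_contra! hkn
        exact hc k hkn hp
      exact_mod_cast this).trans h
  have : n + 1 ≤ n := by exact_mod_cast this
  lia

variable {R : Type u} [Ring R]

lemma hasResolutionOfLength_iff {𝒴 : ObjectProperty (ModuleCat.{u} R)} {n : ℕ}
    {M : ModuleCat.{u} R} :
    HasResolutionOfLength (fun M => HasCompleteProjRes 𝒴 M) n M ↔
      Resolves (IsRelGorensteinProjective 𝒴) n M := by
  have : (fun M => HasCompleteProjRes 𝒴 M) = IsRelGorensteinProjective 𝒴 :=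
    funext fun M => propext hasCompleteProjRes_iff
  rw [this]
  exact ⟨HasBoundedResolution.resolves, Resolves.hasBoundedResolution⟩

lemma hasCoresolutionOfLength_iff {𝒳 : ObjectProperty (ModuleCat.{u} R)} {n : ℕ}
    {M : ModuleCat.{u} R} :
    HasCoresolutionOfLength (fun M => HasCompleteInjRes 𝒳 M) n M ↔
      Resolves (IsRelGorensteinProjective 𝒳.op) n (op M) := by
  have : ObjectProperty.op (fun M => HasCompleteInjRes 𝒳 M) = IsRelGorensteinProjective 𝒳.op :=
    funext fun M => propext hasCompleteInjRes_iff
  rw [HasCoresolutionOfLength, ← hasBoundedResolution_op_iff, this]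
  exact ⟨HasBoundedResolution.resolves, Resolves.hasBoundedResolution⟩

lemma iSup_resolutionDim_le_iff {𝒴 : ObjectProperty (ModuleCat.{u} R)} {n : ℕ} :
    (⨆ M : ModuleCat.{u} R, resolutionDim (fun M => HasCompleteProjRes 𝒴 M) M) ≤ n ↔
      ∀ M : ModuleCat.{u} R, ∃ k ≤ n, Resolves (IsRelGorensteinProjective 𝒴) k M := by
  simp only [iSup_le_iff, resolutionDim, iInf_natCast_le_iff, hasResolutionOfLength_iff]

lemma iSup_coresolutionDim_le_iff {𝒳 : ObjectProperty (ModuleCat.{u} R)} {n : ℕ} :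
    (⨆ M : ModuleCat.{u} R, coresolutionDim (fun M => HasCompleteInjRes 𝒳 M) M) ≤ n ↔
      ∀ M : (ModuleCat.{u} R)ᵒᵖ, ∃ k ≤ n, Resolves (IsRelGorensteinProjective 𝒳.op) k M := by
  simp only [iSup_le_iff, coresolutionDim, iInf_natCast_le_iff, hasCoresolutionOfLength_iff]
  exact ⟨fun h M => h M.unop, fun h M => h (op M)⟩

variable (R)

lemma spll_le_iff (n : ℕ) :
    spll R ≤ n ↔ ∀ L : ModuleCat.{u} R, IsLevel L → HasProjectiveDimensionLE L n := by
  simp only [spll, iSup_le_iff, projectiveDimension_le_iff]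

lemma silac_le_iff (n : ℕ) :
    silac R ≤ n ↔ ∀ A : ModuleCat.{u} R, IsAbsolutelyClean A → HasInjectiveDimensionLE A n := by
  simp only [silac, iSup_le_iff, injectiveDimension_le_iff]

/-- Finite projective dimension implies finite injective dimension if projectives have finite
injective dimension. -/
lemma hasInjectiveDimensionLE_of_hasProjectiveDimensionLT [EnoughProjectives C] {n : ℕ}
    (hP : ∀ P : C, Projective P → HasInjectiveDimensionLE P n) {k : ℕ} {M : C}
    (hM : HasProjectiveDimensionLT M (k + 1)) : HasInjectiveDimensionLE M n := by
  induction k generalizing M with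
  | zero => exact hP M (projective_iff_hasProjectiveDimensionLT_one.2 hM)
  | succ k ih =>
    have hS : (ShortComplex.mk (kernel.ι (Projective.π M)) (Projective.π M)
      (kernel.condition _)).ShortExact := { exact := ShortComplex.exact_kernel _ }
    have h₁ := ih ((hS.hasProjectiveDimensionLT_X₃_iff k inferInstance).1 hM)
    -- A quotient in a short exact sequence may use a bound one larger on the kernel, so `n` does
    -- not grow with `k`.
    have := hasInjectiveDimensionLT_of_ge (kernel (Projective.π M)) (n + 1) (n + 1 + 1) (by simp)
    exact hS.hasInjectiveDimensionLT_X₃ (n + 1) (hP _ inferInstance) this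

lemma gPacGldim_le_iff (n : ℕ) :
    gPacGldim R ≤ n ↔ gGldim R ≤ n ∧ spll R ≤ n := by
  rw [spll_le_iff]
  refine (iSup_resolutionDim_le_iff (𝒴 := fun L : ModuleCat.{u} R => IsLevel L)).trans
    (Iff.trans ?_ (and_congr_left fun _ => iSup_resolutionDim_le_iff.symm))
  constructor
  · intro h
    have hP : ∀ P : ModuleCat.{u} R, Projective P → IsLevel P := fun P _ => isLevel_of_projective P
    -- Applied twice: to injectives, of injective dimension less than `1`, and to level modules,
    -- whose injective dimension is already bounded by `h`.
    have hpd := hasProjectiveDimensionLE_of_resolves hP h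
    refine ⟨fun M => ⟨n, le_rfl, resolves_of_hasProjectiveDimensionLE
      (fun I _ => hpd I 1) (fun P h' => ⟨n + 1, hasInjectiveDimensionLE_of_resolves h (hP P h')⟩) M⟩,
      fun L hL => ?_⟩
    have := hasInjectiveDimensionLE_of_resolves h hL
    exact hpd L (n + 1)
  · rintro ⟨h, hL⟩ M
    refine ⟨n, le_rfl, resolves_of_hasProjectiveDimensionLE
      (fun I _ => hasProjectiveDimensionLE_of_resolves (fun _ h => h) h I 1)
      (fun L hL' => ⟨n + 1, hasInjectiveDimensionLE_of_hasProjectiveDimensionLT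
        (fun P hP => hasInjectiveDimensionLE_of_resolves h hP) (hL L hL')⟩) M⟩

lemma gIacGldim_le_iff (n : ℕ) :
    gIacGldim R ≤ n ↔ gGldim R ≤ n ∧ silac R ≤ n := by
  rw [silac_le_iff]
  refine (iSup_coresolutionDim_le_iff (𝒳 := fun A : ModuleCat.{u} R => IsAbsolutelyClean A)).trans
    (Iff.trans ?_ (and_congr_left fun _ => iSup_resolutionDim_le_iff.symm))
  constructor
  · intro h
    have hI : ∀ P : (ModuleCat.{u} R)ᵒᵖ, Projective P →
        ObjectProperty.op (fun A : ModuleCat.{u} R => IsAbsolutelyClean A) P := fun P hP => by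
      have : Injective P.unop := Injective.injective_iff_projective_op.2 hP
      exact isAbsolutelyClean_of_injective P.unop
    -- Fact (B) in the opposite category: finite projective dimension bounds injective dimension.
    -- `hpd` is fact (A) there.
    have hid : ∀ (L : ModuleCat.{u} R) (m : ℕ), HasProjectiveDimensionLT L m →
        HasInjectiveDimensionLE L n := fun L m hL => by
      have := hasInjectiveDimensionLT_op hL
      exact hasInjectiveDimensionLT_of_op (hasProjectiveDimensionLE_of_resolves hI h (op L) m)
    have hpd : ∀ A : ModuleCat.{u} R, IsAbsolutelyClean A → HasProjectiveDimensionLE A n :=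
      fun A hA => hasProjectiveDimensionLT_of_op
        (hasInjectiveDimensionLE_of_resolves h (Y := op A) hA)
    refine ⟨fun M => ⟨n, le_rfl, resolves_of_hasProjectiveDimensionLE
      (fun I _ => hpd I (isAbsolutelyClean_of_injective I))
      (fun P hP => ⟨n + 1, hid P 1 (projective_iff_hasProjectiveDimensionLT_one.1 hP)⟩) M⟩,
      fun A hA => hid A (n + 1) (hpd A hA)⟩
  · rintro ⟨h, hA⟩ M
    refine ⟨n, le_rfl, resolves_of_hasProjectiveDimensionLE
      (fun I hI => ?_) (fun A hA' => ⟨n + 1, ?_⟩) M⟩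
    · exact hasProjectiveDimensionLT_op (X := I.unop) (hasInjectiveDimensionLE_of_resolves h
        (Injective.projective_iff_injective_op.2 hI))
    · have := hA A.unop hA'
      exact hasInjectiveDimensionLT_op (X := A.unop)
        (hasProjectiveDimensionLE_of_resolves (fun _ h => h) h A.unop (n + 1))

/-- An element of `ℕ∞` is determined by the natural numbers above it, and the maximum lies in `ℕ∞`
because `y` does, even when `z` is `⊥`. -/
lemma coe_eq_max_of_le_iff {x y : ℕ∞} {z : WithBot ℕ∞}
    (h : ∀ n : ℕ, x ≤ n ↔ y ≤ n ∧ z ≤ n) : (x : WithBot ℕ∞) = max (y : WithBot ℕ∞) z := by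
  obtain ⟨w, hw⟩ : ∃ w : ℕ∞, (w : WithBot ℕ∞) = max (y : WithBot ℕ∞) z := by
    induction z with
    | bot => exact ⟨y, by simp⟩
    | coe z => exact ⟨max y z, by simp⟩
  have h' : ∀ n : ℕ, x ≤ n ↔ w ≤ n := fun n => by
    rw [h, ← WithBot.coe_le_coe (a := w), hw, max_le_iff, WithBot.coe_le_coe]
    rfl
  rw [← hw]
  congr 1
  refine le_antisymm ?_ ?_
  · induction w with
    | top => exact le_top
    | coe n => exact (h' n).2 le_rfl
  · induction x with
    | top => exact le_top
    | coe n => exact (h' n).1 le_rfl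

end GlobalDimensions

end GorensteinAC

end

theorem mainTheorem5 (R : Type u) [Ring R] :
    (GorensteinAC.gIacGldim R : WithBot ℕ∞)
        = max (GorensteinAC.gGldim R : WithBot ℕ∞) (GorensteinAC.silac R) ∧
      (GorensteinAC.gPacGldim R : WithBot ℕ∞)
        = max (GorensteinAC.gGldim R : WithBot ℕ∞) (GorensteinAC.spll R) :=
  ⟨GorensteinAC.coe_eq_max_of_le_iff (GorensteinAC.gIacGldim_le_iff R),
    GorensteinAC.coe_eq_max_of_le_iff (GorensteinAC.gPacGldim_le_iff R)⟩
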